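/- Let $p$ be a prime. A ring $k$ is called perfect if $p=0$ in $k$ and $x\mapsto x^p$ is bijective on $k$; $W$ denotes $p$-typical Witt vectors. For a perfect ring $S$, an element $\xi=(\xi_0,\xi_1,\ldots)\in W(S)$ is called distinguished if $\xi_1$ is a unit of $S$ and $S$ is $\xi_0$-adically complete (and separated). A ring is called perfectoid if it is isomorphic to $W(S)/\xi$ with $S$ perfect and $\xi$ distinguished. For a perfectoid ring $R$ let $R^\flat=\varprojlim(R/p,\,x\mapsto x^p)$, and let $A_{\mathrm{cris}}(R)$ be the $p$-adic completion of the divided power envelope of the natural surjection $W(R^\flat)\to R^\flat\to R/p$, where divided powers are required to be compatible with those of $p\mathbb{Z}_p\subset\mathbb{Z}_p$. The ring $A_{\mathrm{cris}}(R)$ is functorial in $R$, and a homomorphism $R\to k$ to a perfect ring $k$ induces a natural homomorphism $A_{\mathrm{cris}}(R)\to W(k)$ (the unique extension of $W(R^\flat)\to W(R/p)\to W(k)$, using the divided powers of $pW(k)$). Let $R=W(S)/\xi$ be a perfectoid ring with $S$ perfect and $\xi$ distinguished. Let $$S_1=S/\operatorname{Ann}(\xi_0),\qquad S_2=S/(\xi_0^{p^{-\infty}}),\qquad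 S_{12}=S_1\otimes_S S_2,$$ where $(\xi_0^{p^{-\infty}})$ is the ideal generated by all $p$-power roots of $\xi_0$, and let $R_i=W(S_i)/\xi$ for $i=1,2,12$. Then $R_1$ is a $p$-torsion free perfectoid ring, $R_2$ and $R_{12}$ are perfect rings, and there is an exact sequence $$0\to A_{\mathrm{cris}}(R)\xrightarrow{\ \alpha\ }A_{\mathrm{cris}}(R_1)\oplus W(R_2)\xrightarrow{\ \beta\ }W(R_{12})\to 0,$$ where the components of $\alpha$ are the homomorphisms induced by $R\to R_1$ and $R\to R_2$, and $\beta$ is the difference of the homomorphisms induced by $R_1\to R_{12}$ and $R_2\to R_{12}$. In particular, the ring $A_{\mathrm{cris}}(R)$ is $p$-torsion free. -/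

import Mathlib

open scoped TensorProduct

universe v u

noncomputable section

namespace PerfdAcris

/-! ### Divided power envelopes

Let `(A, I, γ)` be a ring with divided powers, `ι : A → B` a ring homomorphism and `J` an ideal of
`B` (to be used when `I B ⊆ J`).  The divided power envelope of `J` relative to `(A, I, γ)` is the
universal divided power ring `(D, J', γ')` with a ring homomorphism `B → D` such that `J D ⊆ J'`
and such that `A → D` is a homomorphism of divided power rings.
It is built as the quotient of the polynomial ring `B[X_{n,x} | n ∈ ℕ, x ∈ J]` by all polynomials
that vanish under `X_{n,x} ↦ δ_n(x)` in every divided power ring `(E, K, δ)` over `B` as above. -/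

section Envelope

variable {A : Type v} {B : Type u} [CommRing A] [CommRing B]

/-- A ring homomorphism `φ : B → E` into a divided power ring `(E, K, δ)` with `J E ⊆ K` such that
the divided powers `δ` are compatible with those of `(A, I, γ)`. -/
structure IsPDTarget {I : Ideal A} (γ : DividedPowers I) (ι : A →+* B) (J : Ideal B)
    {E : Type u} [CommRing E] {K : Ideal E} (δ : DividedPowers K) (φ : B →+* E) : Prop where
  map_le : J.map φ ≤ K
  compat : DividedPowers.IsDPMorphism γ δ (φ.comp ι)

/-- The evaluation `B[X_{n,x}] → E`, `X_{n,x} ↦ δ_n(φ(x))`. -/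
def pdEval (J : Ideal B) {E : Type u} [CommRing E] {K : Ideal E} (δ : DividedPowers K)
    (φ : B →+* E) : MvPolynomial (ℕ × J) B →+* E :=
  MvPolynomial.eval₂Hom φ (fun i : ℕ × J => δ.dpow i.1 (φ i.2))

/-- The ideal of all polynomials in the `X_{n,x}` that vanish in every divided power ring
over `B` as above. -/
def pdRelations {I : Ideal A} (γ : DividedPowers I) (ι : A →+* B) (J : Ideal B) :
    Ideal (MvPolynomial (ℕ × J) B) where
  carrier := {f | ∀ (E : Type u) [CommRing E] (K : Ideal E) (δ : DividedPowers K) (φ : B →+* E),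
    IsPDTarget γ ι J δ φ → pdEval J δ φ f = 0}
  zero_mem' := by
    intro E _ K δ φ _
    exact map_zero _
  add_mem' := by
    intro f g hf hg E _ K δ φ h
    rw [map_add, hf E K δ φ h, hg E K δ φ h, add_zero]
  smul_mem' := by
    intro c f hf E _ K δ φ h
    rw [smul_eq_mul, map_mul, hf E K δ φ h, mul_zero]

/-- The divided power envelope of the ideal `J` of `B` relative to `(A, I, γ)`. -/
def PDEnvelope {I : Ideal A} (γ : DividedPowers I) (ι : A →+* B) (J : Ideal B) : Type u :=
  MvPolynomial (ℕ × J) B ⧸ pdRelations γ ι J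

namespace PDEnvelope

variable {I : Ideal A} (γ : DividedPowers I) (ι : A →+* B) (J : Ideal B)

instance : CommRing (PDEnvelope γ ι J) :=
  inferInstanceAs (CommRing (MvPolynomial (ℕ × J) B ⧸ pdRelations γ ι J))

/-- The quotient map from the polynomial ring. -/
def mk : MvPolynomial (ℕ × J) B →+* PDEnvelope γ ι J := Ideal.Quotient.mk (pdRelations γ ι J)

theorem mk_surjective : Function.Surjective (mk γ ι J) := Ideal.Quotient.mk_surjective

/-- The structure map `B → D`. -/
def of : B →+* PDEnvelope γ ι J := (mk γ ι J).comp MvPolynomial.C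

/-- The divided power `γ_n(x)` in `D` of an element `x` of `J`. -/
def gamma (n : ℕ) (x : J) : PDEnvelope γ ι J := mk γ ι J (MvPolynomial.X (n, x))

/-- The divided power ideal of `D`, generated by the `γ_n(x)` with `n ≥ 1` and `x ∈ J`. -/
def pdIdeal : Ideal (PDEnvelope γ ι J) :=
  Ideal.span {d | ∃ (n : ℕ) (x : J), n ≠ 0 ∧ d = gamma γ ι J n x}

section Lift

variable {γ ι J} {E : Type u} [CommRing E] {K : Ideal E} {δ : DividedPowers K} {φ : B →+* E}

/-- The homomorphism `D → E` given by the universal property. -/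
def lift (h : IsPDTarget γ ι J δ φ) : PDEnvelope γ ι J →+* E :=
  Ideal.Quotient.lift (pdRelations γ ι J) (pdEval J δ φ) (fun _ ha => ha E K δ φ h)

theorem lift_mk (h : IsPDTarget γ ι J δ φ) (f : MvPolynomial (ℕ × J) B) :
    lift h (mk γ ι J f) = pdEval J δ φ f := rfl

theorem lift_of (h : IsPDTarget γ ι J δ φ) (b : B) : lift h (of γ ι J b) = φ b := by
  simp [of, lift_mk, pdEval]

theorem lift_gamma (h : IsPDTarget γ ι J δ φ) (n : ℕ) (x : J) :
    lift h (gamma γ ι J n x) = δ.dpow n (φ x) := by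
  simp [gamma, lift_mk, pdEval]

theorem lift_mem (h : IsPDTarget γ ι J δ φ) {d : PDEnvelope γ ι J} (hd : d ∈ pdIdeal γ ι J) :
    lift h d ∈ K := by
  have : pdIdeal γ ι J ≤ K.comap (lift h) := by
    refine Ideal.span_le.mpr ?_
    rintro _ ⟨n, x, hn, rfl⟩
    change lift h _ ∈ K
    rw [lift_gamma]
    exact δ.dpow_mem hn (h.map_le (Ideal.mem_map_of_mem φ x.2))
  exact this hd

end Lift

theorem eq_of_lift {d d' : PDEnvelope γ ι J}
    (H : ∀ (E : Type u) [CommRing E] (K : Ideal E) (δ : DividedPowers K) (φ : B →+* E)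
      (h : IsPDTarget γ ι J δ φ), lift h d = lift h d') : d = d' := by
  obtain ⟨f, rfl⟩ := mk_surjective γ ι J d
  obtain ⟨g, rfl⟩ := mk_surjective γ ι J d'
  refine Ideal.Quotient.eq.mpr ?_
  intro E _ K δ φ h
  rw [map_sub, sub_eq_zero]
  exact H E K δ φ h

theorem exists_dpow {d : PDEnvelope γ ι J} (hd : d ∈ pdIdeal γ ι J) (m : ℕ) :
    ∃ e : PDEnvelope γ ι J, (m ≠ 0 → e ∈ pdIdeal γ ι J) ∧
      ∀ (E : Type u) [CommRing E] (K : Ideal E) (δ : DividedPowers K) (φ : B →+* E)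
        (h : IsPDTarget γ ι J δ φ), lift h e = δ.dpow m (lift h d) := by
  induction hd using Submodule.span_induction generalizing m with
  | mem d hd =>
    obtain ⟨n, x, hn, rfl⟩ := hd
    refine ⟨(Nat.uniformBell m n : PDEnvelope γ ι J) * gamma γ ι J (m * n) x, ?_, ?_⟩
    · intro hm
      exact Ideal.mul_mem_left _ _ (Ideal.subset_span ⟨m * n, x, mul_ne_zero hm hn, rfl⟩)
    · intro E _ K δ φ h
      rw [map_mul, map_natCast, lift_gamma, lift_gamma,
        δ.dpow_comp hn (h.map_le (Ideal.mem_map_of_mem φ x.2))]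
  | zero =>
    refine ⟨if m = 0 then 1 else 0, ?_, ?_⟩
    · intro hm
      rw [if_neg hm]
      exact zero_mem _
    · intro E _ K δ φ h
      rw [map_zero]
      split_ifs with hm
      · rw [hm, map_one, δ.dpow_zero (zero_mem K)]
      · rw [map_zero, δ.dpow_eval_zero hm]
  | add d d' hd hd' ih ih' =>
    choose e he1 he2 using ih
    choose e' he1' he2' using ih'
    refine ⟨∑ k ∈ Finset.HasAntidiagonal.antidiagonal m, e k.1 * e' k.2, ?_, ?_⟩
    · intro hm
      refine Ideal.sum_mem _ fun k hk => ?_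
      rw [Finset.HasAntidiagonal.mem_antidiagonal] at hk
      by_cases h1 : k.1 = 0
      · exact Ideal.mul_mem_left _ _ (he1' k.2 (by omega))
      · exact Ideal.mul_mem_right _ _ (he1 k.1 h1)
    · intro E _ K δ φ h
      rw [map_sum, map_add, δ.dpow_add (lift_mem h hd) (lift_mem h hd')]
      refine Finset.sum_congr rfl fun k _ => ?_
      rw [map_mul, he2 k.1 E K δ φ h, he2' k.2 E K δ φ h]
  | smul a d hd ih =>
    obtain ⟨e, he1, he2⟩ := ih m
    refine ⟨a ^ m * e, fun hm => Ideal.mul_mem_left _ _ (he1 hm), ?_⟩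
    intro E _ K δ φ h
    rw [smul_eq_mul, map_mul, map_mul, map_pow, he2 E K δ φ h, δ.dpow_mul (lift_mem h hd)]

open Classical in
/-- The divided powers of the divided power envelope. -/
def dpow (m : ℕ) (d : PDEnvelope γ ι J) : PDEnvelope γ ι J :=
  if hd : d ∈ pdIdeal γ ι J then (exists_dpow γ ι J hd m).choose else 0

theorem dpow_mem' {m : ℕ} {d : PDEnvelope γ ι J} (hm : m ≠ 0) (hd : d ∈ pdIdeal γ ι J) :
    dpow γ ι J m d ∈ pdIdeal γ ι J := by
  rw [dpow, dif_pos hd]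
  exact (exists_dpow γ ι J hd m).choose_spec.1 hm

section Lift

variable {γ ι J} {E : Type u} [CommRing E] {K : Ideal E} {δ : DividedPowers K} {φ : B →+* E}

theorem lift_dpow (h : IsPDTarget γ ι J δ φ) {d : PDEnvelope γ ι J} (hd : d ∈ pdIdeal γ ι J)
    (m : ℕ) : lift h (dpow γ ι J m d) = δ.dpow m (lift h d) := by
  rw [dpow, dif_pos hd]
  exact (exists_dpow γ ι J hd m).choose_spec.2 E K δ φ h

end Lift

/-- The divided power structure of the divided power envelope. -/
def dividedPowers : DividedPowers (pdIdeal γ ι J) where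
  dpow := dpow γ ι J
  dpow_null hd := by rw [dpow, dif_neg hd]
  dpow_zero hd := by
    refine eq_of_lift γ ι J fun E _ K δ φ h => ?_
    rw [lift_dpow h hd, map_one, δ.dpow_zero (lift_mem h hd)]
  dpow_one hd := by
    refine eq_of_lift γ ι J fun E _ K δ φ h => ?_
    rw [lift_dpow h hd, δ.dpow_one (lift_mem h hd)]
  dpow_mem hm hd := dpow_mem' γ ι J hm hd
  dpow_add hx hy := by
    refine eq_of_lift γ ι J fun E _ K δ φ h => ?_
    rw [lift_dpow h (add_mem hx hy), map_add, δ.dpow_add (lift_mem h hx) (lift_mem h hy), map_sum]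
    refine Finset.sum_congr rfl fun k _ => ?_
    rw [map_mul, lift_dpow h hx, lift_dpow h hy]
  dpow_mul hx := by
    refine eq_of_lift γ ι J fun E _ K δ φ h => ?_
    rw [lift_dpow h (Ideal.mul_mem_left _ _ hx), map_mul, δ.dpow_mul (lift_mem h hx), map_mul,
      map_pow, lift_dpow h hx]
  mul_dpow hx := by
    refine eq_of_lift γ ι J fun E _ K δ φ h => ?_
    rw [map_mul, map_mul, map_natCast, lift_dpow h hx, lift_dpow h hx, lift_dpow h hx,
      δ.mul_dpow (lift_mem h hx)]
  dpow_comp hn hx := by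
    refine eq_of_lift γ ι J fun E _ K δ φ h => ?_
    rw [map_mul, map_natCast, lift_dpow h (dpow_mem' γ ι J hn hx), lift_dpow h hx, lift_dpow h hx,
      δ.dpow_comp hn (lift_mem h hx)]

theorem of_mem {x : B} (hx : x ∈ J) : of γ ι J x ∈ pdIdeal γ ι J := by
  have : of γ ι J x = gamma γ ι J 1 ⟨x, hx⟩ := by
    refine eq_of_lift γ ι J fun E _ K δ φ h => ?_
    rw [lift_of, lift_gamma, δ.dpow_one (h.map_le (Ideal.mem_map_of_mem φ hx))]
  rw [this]
  exact Ideal.subset_span ⟨1, _, one_ne_zero, rfl⟩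

theorem dpow_of (n : ℕ) (x : J) :
    (dividedPowers γ ι J).dpow n (of γ ι J x) = gamma γ ι J n x := by
  refine eq_of_lift γ ι J fun E _ K δ φ h => ?_
  exact (lift_dpow h (of_mem γ ι J x.2) n).trans (by rw [lift_of, lift_gamma])

/-- The divided power envelope is itself a divided power ring over `B` of the required kind. -/
theorem isPDTarget (hJ : I.map ι ≤ J) :
    IsPDTarget γ ι J (dividedPowers γ ι J) (of γ ι J) where
  map_le := Ideal.map_le_iff_le_comap.mpr fun _ hx => of_mem γ ι J hx
  compat := by
    have hmem : ∀ a ∈ I, of γ ι J (ι a) ∈ pdIdeal γ ι J := fun a ha =>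
      of_mem γ ι J (hJ (Ideal.mem_map_of_mem ι ha))
    refine ⟨Ideal.map_le_iff_le_comap.mpr hmem, fun {n} a ha => ?_⟩
    refine eq_of_lift γ ι J fun E _ K δ φ h => ?_
    refine (lift_dpow h (hmem a ha) n).trans ?_
    rw [RingHom.comp_apply, lift_of, lift_of]
    exact h.compat.dpow_comp a ha

/-- The universal property of the divided power envelope. -/
theorem existsUnique_lift {E : Type u} [CommRing E] {K : Ideal E} {δ : DividedPowers K}
    {φ : B →+* E} (h : IsPDTarget γ ι J δ φ) :
    ∃! g : PDEnvelope γ ι J →+* E,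
      g.comp (of γ ι J) = φ ∧ DividedPowers.IsDPMorphism (dividedPowers γ ι J) δ g := by
  refine ⟨lift h, ⟨RingHom.ext (lift_of h), ?_, ?_⟩, ?_⟩
  · exact Ideal.map_le_iff_le_comap.mpr fun d hd => lift_mem h hd
  · intro n d hd
    exact (lift_dpow h hd n).symm
  · rintro g ⟨hg1, hg2⟩
    refine Ideal.Quotient.ringHom_ext (MvPolynomial.ringHom_ext (fun b => ?_) ?_)
    · exact (RingHom.congr_fun hg1 b).trans (lift_of h b).symm
    · rintro ⟨n, x⟩
      refine Eq.trans ?_ (lift_gamma h n x).symm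
      change g (gamma γ ι J n x) = _
      rw [← dpow_of, ← hg2.dpow_comp _ (of_mem γ ι J x.2)]
      exact congrArg _ (RingHom.congr_fun hg1 x)

end PDEnvelope

end Envelope

/-! ### Perfect rings, distinguished elements and perfectoid rings -/

variable (p : ℕ)

/-- A ring is perfect if `p = 0` in it and the Frobenius `x ↦ x ^ p` is bijective
(the zero ring is perfect). -/
structure IsPerfect (k : Type u) [CommRing k] : Prop where
  p_eq_zero : (p : k) = 0
  bijective_frobenius : Function.Bijective fun x : k => x ^ p

/-- A ring is (`p`-)torsion free if `p` is a non-zero-divisor in it. -/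
def IsTorsionFree (A : Type u) [CommRing A] : Prop :=
  ∀ x : A, (p : A) * x = 0 → x = 0

/-- The ring `R/p`. -/
abbrev ModP (R : Type u) [CommRing R] : Type u := R ⧸ Ideal.span {(p : R)}

theorem ModP.p_eq_zero (R : Type u) [CommRing R] : (p : ModP p R) = 0 := by
  rw [← map_natCast (Ideal.Quotient.mk (Ideal.span {(p : R)}))]
  exact Ideal.Quotient.eq_zero_iff_mem.mpr (Ideal.mem_span_singleton_self _)

/-- The map `R/p → R'/p` induced by `R → R'`. -/
def ModP.map {R R' : Type u} [CommRing R] [CommRing R'] (f : R →+* R') : ModP p R →+* ModP p R' :=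
  Ideal.quotientMap _ f (by
    rw [Ideal.span_singleton_le_iff_mem, Ideal.mem_comap, map_natCast]
    exact Ideal.mem_span_singleton_self _)

/-- The map `lim D/p^n → D/p^n → D'/p^n` induced by `f : D → D'`. -/
def completionMapAux {D D' : Type u} [CommRing D] [CommRing D'] (f : D →+* D') (n : ℕ) :
    AdicCompletion (Ideal.span {(p : D)}) D →+* D' ⧸ Ideal.span {(p : D')} ^ n :=
  (Ideal.quotientMap (Ideal.span {(p : D')} ^ n) f (by
    rw [← Ideal.map_le_iff_le_comap, Ideal.map_pow, Ideal.map_span, Set.image_singleton,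
      map_natCast])).comp
    (AdicCompletion.evalₐ (Ideal.span {(p : D)}) n).toRingHom

theorem completionMapAux_compat {D D' : Type u} [CommRing D] [CommRing D'] (f : D →+* D')
    {m n : ℕ} (hle : m ≤ n) :
    (Ideal.Quotient.factorPow (Ideal.span {(p : D')}) hle).comp (completionMapAux p f n) =
      completionMapAux p f m := by
  refine RingHom.ext fun x => ?_
  obtain ⟨y, rfl⟩ := AdicCompletion.mk_surjective (Ideal.span {(p : D)}) D x
  have hy := AdicCompletion.Ideal.mk_eq_mk (Ideal.span {(p : D)}) hle y
  have h : Ideal.Quotient.mk (Ideal.span {(p : D')} ^ m) (f (y.val n)) =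
      Ideal.Quotient.mk (Ideal.span {(p : D')} ^ m) (f (y.val m)) := by
    have hle' : Ideal.span {(p : D)} ^ m ≤ (Ideal.span {(p : D')} ^ m).comap f := by
      rw [← Ideal.map_le_iff_le_comap, Ideal.map_pow, Ideal.map_span, Set.image_singleton,
        map_natCast]
    rw [Ideal.Quotient.eq] at hy ⊢
    rw [← map_sub]
    exact hle' hy
  simpa [completionMapAux] using h

/-- The ring homomorphism of `p`-adic completions induced by `f : D → D'`. -/
def completionMap {D D' : Type u} [CommRing D] [CommRing D'] (f : D →+* D') :
    AdicCompletion (Ideal.span {(p : D)}) D →+* AdicCompletion (Ideal.span {(p : D')}) D' :=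
  AdicCompletion.liftRingHom (Ideal.span {(p : D')}) (completionMapAux p f)
    (completionMapAux_compat p f)

theorem completionMap_of {D D' : Type u} [CommRing D] [CommRing D'] (f : D →+* D') (d : D) :
    completionMap p f (algebraMap D _ d) = algebraMap D' _ (f d) := by
  refine AdicCompletion.ext_evalₐ (fun n => ?_)
  refine (AdicCompletion.evalₐ_liftRingHom _ _ (completionMapAux_compat p f) n _).trans ?_
  simp [completionMapAux]

variable [Fact p.Prime]

/-- `ξ = (ξ₀, ξ₁, …)` is distinguished if `ξ₁` is a unit and `S` is `ξ₀`-adically complete. -/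
structure IsDistinguished {S : Type u} [CommRing S] (ξ : WittVector p S) : Prop where
  isUnit : IsUnit (ξ.coeff 1)
  complete : IsAdicComplete (Ideal.span {ξ.coeff 0}) S

/-- A ring is perfectoid if it is isomorphic to `W(S)/ξ` with `S` perfect and `ξ` distinguished. -/
def IsPerfectoid (R : Type u) [CommRing R] : Prop :=
  ∃ (S : Type u) (_ : CommRing S) (ξ : WittVector p S),
    IsPerfect p S ∧ IsDistinguished p ξ ∧ Nonempty (R ≃+* WittVector p S ⧸ Ideal.span {ξ})

/-! ### The tilt and the ring `A_cris` -/

/-- The tilt `R^♭ = lim (R/p ← R/p ← ⋯)` with the Frobenius as transition maps. -/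
def Tilt (R : Type u) [CommRing R] : Subring (ℕ → ModP p R) where
  carrier := {f | ∀ n, f (n + 1) ^ p = f n}
  zero_mem' := fun n => zero_pow (Fact.out : p.Prime).ne_zero
  one_mem' := fun n => one_pow p
  mul_mem' := by
    intro f g hf hg n
    rw [Pi.mul_apply, mul_pow, hf n, hg n, Pi.mul_apply]
  add_mem' := by
    intro f g hf hg n
    rw [Pi.add_apply, (Commute.all _ _).add_pow_prime_eq Fact.out, ModP.p_eq_zero, hf n, hg n,
      Pi.add_apply]
    ring
  neg_mem' := by
    intro f hf n
    have h : (f (n + 1) + -f (n + 1)) ^ p = 0 := by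
      rw [add_neg_cancel, zero_pow (Fact.out : p.Prime).ne_zero]
    rw [(Commute.all _ _).add_pow_prime_eq Fact.out, ModP.p_eq_zero, hf n] at h
    simp only [zero_mul, add_zero] at h
    exact (neg_eq_of_add_eq_zero_right h).symm

namespace Tilt

variable {R R' : Type u} [CommRing R] [CommRing R']

theorem p_eq_zero : (p : Tilt p R) = 0 := by
  refine Subtype.ext (funext fun n => ?_)
  have h := congrFun (map_natCast (Tilt p R).subtype p) n
  exact h.trans (ModP.p_eq_zero p R)

/-- The natural map `R^♭ → R/p`. -/
def toModP : Tilt p R →+* ModP p R := (Pi.evalRingHom _ 0).comp (Tilt p R).subtype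

/-- The map `R^♭ → R'^♭` induced by `R → R'`. -/
def map (f : R →+* R') : Tilt p R →+* Tilt p R' :=
  RingHom.codRestrict
    ((RingHom.pi fun n => (ModP.map p f).comp (Pi.evalRingHom _ n)).comp (Tilt p R).subtype)
    (Tilt p R') (fun x n => by
      change ModP.map p f (x.1 (n + 1)) ^ p = ModP.map p f (x.1 n)
      rw [← map_pow, x.2 n])

theorem toModP_map (f : R →+* R') (x : Tilt p R) :
    toModP p (map p f x) = ModP.map p f (toModP p x) := rfl

end Tilt

/-- The structure map `ℤ_p = W(𝔽_p) → W(k)` for a ring `k` with `p = 0`. -/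
def padicToWitt {k : Type u} [CommRing k] (hk : (p : k) = 0) : ℤ_[p] →+* WittVector p k :=
  (WittVector.map (ZMod.castHom (ringChar.dvd hk) k)).comp (WittVector.fromPadicInt p)

theorem map_comp_padicToWitt {k k' : Type u} [CommRing k] [CommRing k'] (hk : (p : k) = 0)
    (hk' : (p : k') = 0) (f : k →+* k') :
    (WittVector.map f).comp (padicToWitt p hk) = padicToWitt p hk' := by
  ext x n
  simp only [padicToWitt, RingHom.comp_apply, WittVector.map_coeff]
  rw [← RingHom.comp_apply]
  exact RingHom.congr_fun (Subsingleton.elim _ _) _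

/-- The natural map `W(R^♭) → R^♭ → R/p`. -/
def wittToModP (R : Type u) [CommRing R] : WittVector p (Tilt p R) →+* ModP p R :=
  (Tilt.toModP p).comp WittVector.constantCoeff

theorem wittToModP_apply (R : Type u) [CommRing R] (x : WittVector p (Tilt p R)) :
    wittToModP p R x = Tilt.toModP p (x.coeff 0) := rfl

/-- The divided power envelope of the natural map `W(R^♭) → R/p`, relative to the
divided powers of `pℤ_p`. -/
abbrev AcrisEnvelope (R : Type u) [CommRing R] : Type u :=
  PDEnvelope (PadicInt.dividedPowers p) (padicToWitt p (Tilt.p_eq_zero p (R := R)))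
    (RingHom.ker (wittToModP p R))

/-- `A_cris(R)`: the `p`-adic completion of the divided power envelope of `W(R^♭) → R/p`. -/
def Acris (R : Type u) [CommRing R] : Type u :=
  AdicCompletion (Ideal.span {(p : AcrisEnvelope p R)}) (AcrisEnvelope p R)

instance (R : Type u) [CommRing R] : CommRing (Acris p R) :=
  inferInstanceAs
    (CommRing (AdicCompletion (Ideal.span {(p : AcrisEnvelope p R)}) (AcrisEnvelope p R)))

/-! ### Functoriality of `A_cris` -/

theorem isPDTarget_map {R R' : Type u} [CommRing R] [CommRing R'] (f : R →+* R') :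
    IsPDTarget (PadicInt.dividedPowers p) (padicToWitt p (Tilt.p_eq_zero p (R := R)))
      (RingHom.ker (wittToModP p R))
      (PDEnvelope.dividedPowers (PadicInt.dividedPowers p)
        (padicToWitt p (Tilt.p_eq_zero p (R := R'))) (RingHom.ker (wittToModP p R')))
      ((PDEnvelope.of (PadicInt.dividedPowers p)
        (padicToWitt p (Tilt.p_eq_zero p (R := R'))) (RingHom.ker (wittToModP p R'))).comp
        (WittVector.map (Tilt.map p f))) := by
  have hp : (Ideal.span {(p : ℤ_[p])}).map (padicToWitt p (Tilt.p_eq_zero p (R := R'))) ≤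
      RingHom.ker (wittToModP p R') := by
    rw [Ideal.map_span, Set.image_singleton, map_natCast, Ideal.span_singleton_le_iff_mem,
      RingHom.mem_ker, map_natCast, ModP.p_eq_zero]
  have h := PDEnvelope.isPDTarget (PadicInt.dividedPowers p) _ _ hp
  refine ⟨?_, ?_⟩
  · rw [← Ideal.map_map]
    refine le_trans (Ideal.map_mono ?_) h.map_le
    rw [Ideal.map_le_iff_le_comap]
    intro x hx
    rw [RingHom.mem_ker, wittToModP_apply] at hx
    rw [Ideal.mem_comap, RingHom.mem_ker, wittToModP_apply, WittVector.map_coeff,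
      Tilt.toModP_map, hx, map_zero]
  · rw [RingHom.comp_assoc, map_comp_padicToWitt p _ (Tilt.p_eq_zero p)]
    exact h.compat

/-- The ring homomorphism `A_cris(R) → A_cris(R')` induced by `R → R'`. -/
def Acris.map {R R' : Type u} [CommRing R] [CommRing R'] (f : R →+* R') :
    Acris p R →+* Acris p R' :=
  completionMap p (PDEnvelope.lift (isPDTarget_map p f))

/-! ### Divided powers on `p W(k)` and the map `A_cris(R) → W(k)` for perfect `k` -/

section WittPerfect

variable {k : Type u} [CommRing k]

theorem witt_isTorsionFree (hk : IsPerfect p k) : IsTorsionFree p (WittVector p k) := by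
  intro x hx
  rcases subsingleton_or_nontrivial k with h | h
  · ext n
    exact Subsingleton.elim _ _
  · have : CharP k p := (CharP.charP_iff_prime_eq_zero Fact.out).mpr hk.p_eq_zero
    have : PerfectRing k p := ⟨hk.bijective_frobenius⟩
    exact WittVector.eq_zero_of_p_mul_eq_zero x (by rw [mul_comm, hx])

theorem witt_mem_span_p (hk : IsPerfect p k) {x : WittVector p k} (hx : x.coeff 0 = 0) :
    x ∈ Ideal.span {(p : WittVector p k)} := by
  rcases subsingleton_or_nontrivial k with h | h
  · have : x = 0 := by
      ext n
      exact Subsingleton.elim _ _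
    rw [this]
    exact zero_mem _
  · have : CharP k p := (CharP.charP_iff_prime_eq_zero Fact.out).mpr hk.p_eq_zero
    have : PerfectRing k p := ⟨hk.bijective_frobenius⟩
    exact (WittVector.mem_span_p_iff_coeff_zero_eq_zero x).mpr hx

theorem witt_isAdicComplete (hk : IsPerfect p k) :
    IsAdicComplete (Ideal.span {(p : WittVector p k)}) (WittVector p k) := by
  rcases subsingleton_or_nontrivial k with h | h
  · have : Subsingleton (WittVector p k) := ⟨fun x y => by
      ext n
      exact Subsingleton.elim _ _⟩
    infer_instance
  · have : CharP k p := (CharP.charP_iff_prime_eq_zero Fact.out).mpr hk.p_eq_zero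
    have : PerfectRing k p := ⟨hk.bijective_frobenius⟩
    infer_instance

theorem factorial_cancel (hk : IsPerfect p k) (n : ℕ) {x y : WittVector p k}
    (h : (n.factorial : WittVector p k) * x = n.factorial * y) : x = y := by
  have hpow : ∀ (m : ℕ) (z : WittVector p k), (p : WittVector p k) ^ m * z = 0 → z = 0 := by
    intro m
    induction m with
    | zero => intro z hz; simpa using hz
    | succ m ih =>
      intro z hz
      refine witt_isTorsionFree p hk _ (ih _ ?_)
      rw [← mul_assoc, ← pow_succ, hz]
  have hn : (n.factorial : ℤ_[p]) ≠ 0 := Nat.cast_ne_zero.mpr n.factorial_ne_zero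
  have hs := congrArg (padicToWitt p hk.p_eq_zero) (PadicInt.unitCoeff_spec hn)
  rw [map_mul, map_pow, map_natCast, map_natCast] at hs
  have hu : IsUnit (padicToWitt p hk.p_eq_zero (PadicInt.unitCoeff hn : ℤ_[p])) :=
    (PadicInt.unitCoeff hn).isUnit.map _
  rw [← sub_eq_zero, ← mul_sub, hs, mul_assoc] at h
  rw [← sub_eq_zero]
  exact hpow _ _ ((hu.mul_right_eq_zero).mp h)

open Classical in
/-- `x ^ n / n!` for `x ∈ p W(k)`. -/
def wittDPow (n : ℕ) (x : WittVector p k) : WittVector p k :=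
  if h : ∃ y, (n.factorial : WittVector p k) * y = x ^ n ∧ x ∈ Ideal.span {(p : WittVector p k)}
  then h.choose else 0

theorem padic_factorial_mul_dpow (n : ℕ) :
    (n.factorial : ℤ_[p]) * (PadicInt.dividedPowers p).dpow n (p : ℤ_[p]) = (p : ℤ_[p]) ^ n :=
  DividedPowers.factorial_mul_dpow_eq_pow _ (Ideal.mem_span_singleton_self _)

theorem factorial_mul_wittDPow (hk : IsPerfect p k) (n : ℕ) {x : WittVector p k}
    (hx : x ∈ Ideal.span {(p : WittVector p k)}) :
    (n.factorial : WittVector p k) * wittDPow p n x = x ^ n := by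
  have h : ∃ y, (n.factorial : WittVector p k) * y = x ^ n ∧
      x ∈ Ideal.span {(p : WittVector p k)} := by
    obtain ⟨z, rfl⟩ := Ideal.mem_span_singleton'.mp hx
    have h := congrArg (padicToWitt p hk.p_eq_zero) (padic_factorial_mul_dpow p n)
    rw [map_mul, map_pow, map_natCast, map_natCast] at h
    exact ⟨z ^ n * _, by rw [mul_left_comm, h, mul_pow], hx⟩
  rw [wittDPow, dif_pos h]
  exact h.choose_spec.1

theorem wittDPow_mem (hk : IsPerfect p k) {n : ℕ} (hn : n ≠ 0) {x : WittVector p k}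
    (hx : x ∈ Ideal.span {(p : WittVector p k)}) :
    wittDPow p n x ∈ Ideal.span {(p : WittVector p k)} := by
  obtain ⟨z, rfl⟩ := Ideal.mem_span_singleton'.mp hx
  have hm := Ideal.mem_map_of_mem (padicToWitt p hk.p_eq_zero)
    ((PadicInt.dividedPowers p).dpow_mem hn (Ideal.mem_span_singleton_self (p : ℤ_[p])))
  rw [Ideal.map_span, Set.image_singleton, map_natCast] at hm
  have h := congrArg (padicToWitt p hk.p_eq_zero) (padic_factorial_mul_dpow p n)
  rw [map_mul, map_pow, map_natCast, map_natCast] at h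
  have := factorial_mul_wittDPow p hk n hx
  rw [mul_pow, ← h, mul_left_comm] at this
  rw [factorial_cancel p hk n this]
  exact Ideal.mul_mem_left _ _ hm

/-- The divided power structure `x ^ n / n!` on the ideal `p W(k)`, for `k` perfect. -/
def wittDividedPowers (hk : IsPerfect p k) :
    DividedPowers (Ideal.span {(p : WittVector p k)}) where
  dpow := wittDPow p
  dpow_null hx := by
    rw [wittDPow, dif_neg]
    rintro ⟨y, -, h⟩
    exact hx h
  dpow_zero {x} hx := by
    have := factorial_mul_wittDPow p hk 0 hx
    simpa using this
  dpow_one {x} hx := by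
    have := factorial_mul_wittDPow p hk 1 hx
    simpa using this
  dpow_mem hn hx := wittDPow_mem p hk hn hx
  dpow_add {n x y} hx hy := by
    refine factorial_cancel p hk n ?_
    rw [factorial_mul_wittDPow p hk n (add_mem hx hy), Commute.add_pow' (Commute.all x y),
      Finset.mul_sum]
    refine Finset.sum_congr rfl fun c hc => ?_
    rw [Finset.HasAntidiagonal.mem_antidiagonal] at hc
    subst hc
    have h4 : ((Nat.choose (c.1 + c.2) c.1 : ℕ) : WittVector p k) * c.1.factorial * c.2.factorial
        = (c.1 + c.2).factorial := by
      exact_mod_cast congrArg (Nat.cast (R := WittVector p k))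
        (Nat.choose_symm_add (a := c.1) (b := c.2) ▸
          Nat.add_choose_mul_factorial_mul_factorial c.1 c.2)
    rw [← factorial_mul_wittDPow p hk c.1 hx, ← factorial_mul_wittDPow p hk c.2 hy, ← h4,
      nsmul_eq_mul]
    ring
  dpow_mul {n a x} hx := by
    refine factorial_cancel p hk n ?_
    rw [factorial_mul_wittDPow p hk n (Ideal.mul_mem_left _ _ hx), mul_left_comm,
      factorial_mul_wittDPow p hk n hx, mul_pow]
  mul_dpow {m n x} hx := by
    refine factorial_cancel p hk m (factorial_cancel p hk n ?_)
    have h1 := factorial_mul_wittDPow p hk m hx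
    have h2 := factorial_mul_wittDPow p hk n hx
    have h3 := factorial_mul_wittDPow p hk (m + n) hx
    have h4 : ((Nat.choose (m + n) m : ℕ) : WittVector p k) * m.factorial * n.factorial
        = (m + n).factorial := by
      exact_mod_cast congrArg (Nat.cast (R := WittVector p k))
        (Nat.choose_symm_add (a := m) (b := n) ▸
          Nat.add_choose_mul_factorial_mul_factorial m n)
    calc _ = ((m.factorial : WittVector p k) * wittDPow p m x) *
          (n.factorial * wittDPow p n x) := by ring
      _ = (m + n).factorial * wittDPow p (m + n) x := by rw [h1, h2, h3, pow_add]
      _ = _ := by rw [← h4]; ring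
  dpow_comp {m n x} hn hx := by
    have hnx := wittDPow_mem p hk hn hx
    have h1 := factorial_mul_wittDPow p hk m hnx
    have h2 := factorial_mul_wittDPow p hk n hx
    have h3 := factorial_mul_wittDPow p hk (m * n) hx
    have h4 : ((Nat.uniformBell m n : ℕ) : WittVector p k) * n.factorial ^ m * m.factorial
        = (m * n).factorial := by
      exact_mod_cast congrArg (Nat.cast (R := WittVector p k)) (Nat.uniformBell_mul_eq m hn)
    have key : ∀ j : ℕ, ∀ a b : WittVector p k,
        (n.factorial : WittVector p k) ^ j * a = (n.factorial : WittVector p k) ^ j * b →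
          a = b := by
      intro j
      induction j with
      | zero => intro a b hab; simpa using hab
      | succ j ih =>
        intro a b hab
        refine factorial_cancel p hk n (ih _ _ ?_)
        rw [← mul_assoc, ← mul_assoc, ← pow_succ, hab]
    refine factorial_cancel p hk m (key m _ _ ?_)
    calc _ = (n.factorial : WittVector p k) ^ m *
          (m.factorial * wittDPow p m (wittDPow p n x)) := by ring
      _ = (n.factorial * wittDPow p n x) ^ m := by rw [h1, mul_pow]
      _ = (m * n).factorial * wittDPow p (m * n) x := by rw [h2, h3, ← pow_mul, mul_comm m n]
      _ = _ := by rw [← h4]; ring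

/-- The map `R/p → k` induced by `f : R → k` when `p = 0` in `k`. -/
def ModP.lift {R : Type u} [CommRing R] (f : R →+* k) (hk : (p : k) = 0) : ModP p R →+* k :=
  Ideal.Quotient.lift _ f (by
    intro a ha
    obtain ⟨b, rfl⟩ := Ideal.mem_span_singleton'.mp ha
    rw [map_mul, map_natCast, hk, mul_zero])

/-- The map `W(R^♭) → W(R/p) → W(k)` induced by `f : R → k` when `p = 0` in `k`. -/
def ainfToWitt {R : Type u} [CommRing R] (f : R →+* k) (hk : (p : k) = 0) :
    WittVector p (Tilt p R) →+* WittVector p k :=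
  WittVector.map ((ModP.lift p f hk).comp (Tilt.toModP p))

theorem isPDTarget_ainfToWitt {R : Type u} [CommRing R] (f : R →+* k) (hk : IsPerfect p k) :
    IsPDTarget (PadicInt.dividedPowers p) (padicToWitt p (Tilt.p_eq_zero p (R := R)))
      (RingHom.ker (wittToModP p R)) (wittDividedPowers p hk)
      (ainfToWitt p f hk.p_eq_zero) := by
  refine ⟨?_, ?_⟩
  · rw [Ideal.map_le_iff_le_comap]
    intro x hx
    rw [RingHom.mem_ker, wittToModP_apply] at hx
    refine witt_mem_span_p p hk ?_
    rw [ainfToWitt, WittVector.map_coeff, RingHom.comp_apply, hx, map_zero]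
  · rw [ainfToWitt, map_comp_padicToWitt p _ hk.p_eq_zero]
    have hle : (Ideal.span {(p : ℤ_[p])}).map (padicToWitt p hk.p_eq_zero) ≤
        Ideal.span {(p : WittVector p k)} := by
      rw [Ideal.map_span, Set.image_singleton, map_natCast]
    refine ⟨hle, fun {n} a ha => factorial_cancel p hk n ?_⟩
    refine (factorial_mul_wittDPow p hk n (hle (Ideal.mem_map_of_mem _ ha))).trans ?_
    rw [← map_pow, ← DividedPowers.factorial_mul_dpow_eq_pow (PadicInt.dividedPowers p) ha,
      map_mul, map_natCast]

/-- The ring homomorphism `A_cris(R) → W(k)` induced by `f : R → k` for a perfect ring `k`: the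
`p`-adic completion of the divided power homomorphism `AcrisEnvelope p R → W(k)` that extends
`W(R^♭) → W(k)`. -/
def Acris.toWitt {R : Type u} [CommRing R] (f : R →+* k) (hk : IsPerfect p k) :
    Acris p R →+* WittVector p k :=
  haveI := witt_isAdicComplete p hk
  (AdicCompletion.ofAlgEquiv (Ideal.span {(p : WittVector p k)})).symm.toRingEquiv.toRingHom.comp
    (completionMap p (PDEnvelope.lift (isPDTarget_ainfToWitt p f hk)))

end WittPerfect

/-! ### The decomposition of a perfectoid ring -/

section Decomposition

variable {S : Type u} [CommRing S]

/-- `S₁ = S / Ann(a)`. -/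
abbrev S₁ (a : S) : Type u := S ⧸ (Ideal.span {a}).annihilator

/-- The ideal `(a^{p^{-∞}})` generated by all `p`-power roots of `a`. -/
def rootIdeal (a : S) : Ideal S := Ideal.span {x | ∃ n : ℕ, x ^ p ^ n = a}

/-- `S₂ = S / (a^{p^{-∞}})`. -/
abbrev S₂ (a : S) : Type u := S ⧸ rootIdeal p a

/-- `S₁₂ = S₁ ⊗_S S₂`. -/
abbrev S₁₂ (a : S) : Type u := S₁ a ⊗[S] S₂ p a

/-- `W(T)/ξ` for an `S`-algebra `T`. -/
abbrev WittQuot (ξ : WittVector p S) (T : Type u) [CommRing T] [Algebra S T] : Type u :=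
  WittVector p T ⧸ Ideal.span {WittVector.map (algebraMap S T) ξ}

/-- The map `W(S)/ξ → W(T)/ξ`. -/
def WittQuot.ofBase (ξ : WittVector p S) (T : Type u) [CommRing T] [Algebra S T] :
    WittVector p S ⧸ Ideal.span {ξ} →+* WittQuot p ξ T :=
  Ideal.quotientMap _ (WittVector.map (algebraMap S T)) (by
    rw [Ideal.span_singleton_le_iff_mem, Ideal.mem_comap]
    exact Ideal.mem_span_singleton_self _)

/-- The map `W(T)/ξ → W(T')/ξ` induced by a homomorphism of `S`-algebras `T → T'`. -/
def WittQuot.map (ξ : WittVector p S) {T T' : Type u} [CommRing T] [Algebra S T] [CommRing T']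
    [Algebra S T'] (f : T →ₐ[S] T') : WittQuot p ξ T →+* WittQuot p ξ T' :=
  Ideal.quotientMap _ (WittVector.map f.toRingHom) (by
    rw [Ideal.span_singleton_le_iff_mem, Ideal.mem_comap]
    have : WittVector.map f.toRingHom (WittVector.map (algebraMap S T) ξ) =
        WittVector.map (algebraMap S T') ξ := by
      ext n
      simp [WittVector.map_coeff]
    rw [this]
    exact Ideal.mem_span_singleton_self _)

end Decomposition

end PerfdAcris

end

noncomputable section

namespace PerfdAcris

variable (p : ℕ) [Fact p.Prime]

/-! ### Perfect rings -/

section Perfect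

variable {p} {T T' : Type u} [CommRing T] [CommRing T']

/-! Put `T = R^♭`, which is identified with `S`, and let `a ∈ T` correspond to `ξ₀`. The kernel of
`W(T) → R/p` consists of the `x` with `x₀ ∈ aT`, that is, it is `(p, [a])`. Let `D` be its divided
power envelope and `D₁` the analogous one for `T₁ = T/Ann(a) = R₁^♭`. The theorem is deduced from
the exactness, before completion, of `0 → D → D₁ × W(R₂) → W(R₁₂) → 0`.

As a `W(T)`-module `D` is spanned by the `γ_n([a])` (`exists_eq_sum_teichGamma`), so `D → D₁` is
surjective. Its kernel is the image of `W(Ann(a))`, the Witt vectors with all coefficients in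
`Ann(a)` (`exists_eq_wittOf_of_lift_eq_zero`). Two facts give this. First, `W(Ann(a))` kills
`γ_n([a])` for `n ≥ 1` (`wittOf_mul_teichGamma`). Second, `a` is regular in the reduced ring `T₁`,
so `[a]` is regular modulo every `n ≥ 1` in `W(T₁)`. A relation `∑ w_n [a]^n / n! = 0` in the total
fraction ring of `W(T₁)` then forces the top coefficient `w_n` to be divisible by `n`, and `n
γ_n([a]) = [a] γ_{n-1}([a])` shortens the relation until only `γ_0 = 1` is left.

On the other side, `Ann(a)` meets `(a^{p^{-∞}})` in `0` because `S` is reduced, and it maps onto the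
kernel of `S₂ → S₁₂`. Hence `W(Ann(a))` maps isomorphically onto the kernel of `W(R₂) → W(R₁₂)`.
Comparing the two kernels yields the exact sequence for `D`. Since `W(R₁₂)` is `p`-torsion free, the
sequence stays exact modulo `p^n` and passes to `p`-adic completions (`exact_completion`). Moreover
`D` embeds into the torsion free ring `D₁ × W(R₂)`, and completion preserves torsion freeness. -/

omit [Fact p.Prime] in
theorem IsPerfect.pow_injective (hT : IsPerfect p T) (m : ℕ) :
    Function.Injective fun x : T => x ^ p ^ m := by
  induction m with
  | zero => intro x y h; simpa using h
  | succ m ih =>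
    intro x y h
    simp only [pow_succ, pow_mul] at h
    exact ih (hT.bijective_frobenius.1 h)

omit [Fact p.Prime] in
theorem IsPerfect.pow_surjective (hT : IsPerfect p T) (m : ℕ) :
    Function.Surjective fun x : T => x ^ p ^ m := by
  induction m with
  | zero => intro x; exact ⟨x, by simp⟩
  | succ m ih =>
    intro x
    obtain ⟨y, rfl⟩ := hT.bijective_frobenius.2 x
    obtain ⟨z, rfl⟩ := ih y
    exact ⟨z, by simp only [pow_succ, pow_mul]⟩

/-- Perfect rings are reduced: `n ≤ p ^ n`, so `x ^ p ^ n = 0`, and iterated Frobenius is injective.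
-/
theorem IsPerfect.eq_zero_of_pow_eq_zero (hT : IsPerfect p T) {x : T} {n : ℕ}
    (h : x ^ n = 0) : x = 0 := by
  have hp : 1 < p := (Fact.out : p.Prime).one_lt
  refine hT.pow_injective n ?_
  have h0 : p ^ n ≠ 0 := pow_ne_zero _ (Fact.out : p.Prime).ne_zero
  change x ^ p ^ n = 0 ^ p ^ n
  rw [zero_pow h0]
  exact pow_eq_zero_of_le (Nat.lt_pow_self hp).le h

theorem IsPerfect.mul_eq_zero_of_sq_mul (hT : IsPerfect p T) {a x : T}
    (h : a * (a * x) = 0) : a * x = 0 := by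
  refine hT.eq_zero_of_pow_eq_zero (n := 2) ?_
  linear_combination x * h

/-- By reducedness `Ann(a)` is closed under roots. This makes `T/Ann(a)` perfect and allows an
element of `Ann(a)` to be replaced by an arbitrarily high `p`-power root. -/
theorem IsPerfect.mul_eq_zero_of_mul_pow (hT : IsPerfect p T) {a x : T} {n : ℕ} (hn : n ≠ 0)
    (h : a * x ^ n = 0) : a * x = 0 := by
  refine hT.eq_zero_of_pow_eq_zero (n := n) ?_
  obtain ⟨m, rfl⟩ := Nat.exists_eq_succ_of_ne_zero hn
  rw [mul_pow, pow_succ a, mul_assoc, h, mul_zero]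

/-- If `T` is perfect and `T → T'` is surjective with a kernel closed under `p`-th roots, then
`T'` is perfect. -/
theorem IsPerfect.of_surjective (hT : IsPerfect p T) (f : T →+* T') (hf : Function.Surjective f)
    (hker : ∀ x, f (x ^ p) = 0 → f x = 0) : IsPerfect p T' := by
  have hp : (p : T') = 0 := by rw [← map_natCast f, hT.p_eq_zero, map_zero]
  refine ⟨hp, ?_, ?_⟩
  · intro x y hxy
    obtain ⟨x, rfl⟩ := hf x
    obtain ⟨y, rfl⟩ := hf y
    have h2 : x ^ p = (x - y) ^ p + y ^ p := by
      obtain ⟨c, hc⟩ := (Commute.all (x - y) y).exists_add_pow_prime_eq (Fact.out : p.Prime)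
      rw [sub_add_cancel] at hc
      rw [hc, hT.p_eq_zero]
      ring
    rw [← sub_eq_zero, ← map_sub]
    refine hker _ ?_
    rw [eq_sub_of_add_eq h2.symm, map_sub, map_pow, map_pow]
    exact sub_eq_zero.mpr hxy
  · intro x
    obtain ⟨x, rfl⟩ := hf x
    obtain ⟨y, rfl⟩ := hT.bijective_frobenius.2 x
    exact ⟨f y, (map_pow f y p).symm⟩

theorem IsPerfect.of_equiv (hT : IsPerfect p T) (f : T ≃+* T') : IsPerfect p T' := by
  refine hT.of_surjective f.toRingHom f.surjective fun x hx => ?_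
  have : x ^ p = 0 := f.injective (hx.trans (map_zero f).symm)
  rw [hT.eq_zero_of_pow_eq_zero this, map_zero]

end Perfect

/-! ### Witt vectors of perfect rings -/

section Witt

variable {p} {T T' : Type u} [CommRing T] [CommRing T']

theorem witt_coeff_zero_natCast_p (hT : (p : T) = 0) : (p : WittVector p T).coeff 0 = 0 := by
  change WittVector.constantCoeff (p : WittVector p T) = 0
  rw [map_natCast, hT]

theorem witt_exists_add_p_mul (hT : IsPerfect p T) (x : WittVector p T) :
    ∃ y, x = WittVector.teichmuller p (x.coeff 0) + p * y := by
  have h : (x - WittVector.teichmuller p (x.coeff 0)).coeff 0 = 0 := by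
    change WittVector.constantCoeff (x - WittVector.teichmuller p (x.coeff 0)) = 0
    rw [map_sub]
    simp
  obtain ⟨y, hy⟩ := Ideal.mem_span_singleton'.mp (witt_mem_span_p p hT h)
  exact ⟨y, by rw [mul_comm, hy]; ring⟩

theorem witt_p_mul_cancel (hT : IsPerfect p T) {x y : WittVector p T}
    (h : (p : WittVector p T) * x = p * y) : x = y := by
  rw [← sub_eq_zero] at h ⊢
  exact witt_isTorsionFree p hT _ (by rw [mul_sub, h])

theorem witt_p_pow_mul_cancel (hT : IsPerfect p T) (n : ℕ) {x y : WittVector p T}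
    (h : (p : WittVector p T) ^ n * x = p ^ n * y) : x = y := by
  induction n with
  | zero => simpa using h
  | succ n ih =>
    refine ih (witt_p_mul_cancel hT ?_)
    linear_combination h

theorem witt_map_eq_zero_iff (f : T →+* T') {x : WittVector p T} :
    WittVector.map f x = 0 ↔ ∀ n, f (x.coeff n) = 0 := by
  rw [WittVector.ext_iff]
  simp [WittVector.map_coeff]

/-- The factorization of `n` into a unit and a power of `p` already exists in `ℤ_p` and is
transported along `ℤ_p → W(T)`. -/
theorem witt_natCast_associated (hT : (p : T) = 0) {n : ℕ} (hn : n ≠ 0) :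
    ∃ k, Associated ((p : WittVector p T) ^ k) (n : WittVector p T) := by
  have hn' : (n : ℤ_[p]) ≠ 0 := Nat.cast_ne_zero.mpr hn
  have hs := congrArg (padicToWitt p hT) (PadicInt.unitCoeff_spec hn')
  rw [map_mul, map_pow, map_natCast, map_natCast] at hs
  exact ⟨_, Units.map (padicToWitt p hT : ℤ_[p] →* WittVector p T) (PadicInt.unitCoeff hn'),
    by rw [hs, mul_comm]; rfl⟩

theorem witt_natCast_mul_cancel (hT : IsPerfect p T) {n : ℕ} (hn : n ≠ 0) {x y : WittVector p T}
    (h : (n : WittVector p T) * x = n * y) : x = y := by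
  obtain ⟨k, u, hu⟩ := witt_natCast_associated hT.p_eq_zero hn
  refine witt_p_pow_mul_cancel hT k (u.isUnit.mul_left_cancel ?_)
  rw [← hu] at h
  linear_combination h

/-- If `a` is a nonzerodivisor in the perfect ring `T`, then `[a]` is a nonzerodivisor modulo
every integer `n ≥ 1`. -/
theorem witt_dvd_of_dvd_mul_teichmuller_pow (hT : IsPerfect p T) {a : T}
    (ha : ∀ x, a * x = 0 → x = 0) {n : ℕ} (hn : n ≠ 0) (m : ℕ) {y : WittVector p T}
    (h : (n : WittVector p T) ∣ y * WittVector.teichmuller p a ^ m) :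
    (n : WittVector p T) ∣ y := by
  obtain ⟨k, hk⟩ := witt_natCast_associated hT.p_eq_zero hn
  rw [← hk.dvd_iff_dvd_left] at h ⊢
  clear hk
  induction m with
  | zero => simpa using h
  | succ m ih =>
    refine ih ?_
    rw [pow_succ, ← mul_assoc] at h
    -- It remains to cancel a single factor `[a]`, by induction on the exponent of `p`.
    generalize y * WittVector.teichmuller p a ^ m = y at h
    clear ih
    induction k generalizing y with
    | zero => simp
    | succ k ih =>
      obtain ⟨z, hz⟩ := h
      -- Modulo `p` the relation `y [a] = p ^ (k + 1) z` becomes `y₀ a = 0`.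
      have h0 : y.coeff 0 = 0 := by
        refine ha _ ?_
        have := congrArg WittVector.constantCoeff hz
        rw [map_mul, map_mul, map_pow, map_natCast, hT.p_eq_zero, zero_pow k.succ_ne_zero,
          zero_mul] at this
        rw [mul_comm]
        simpa using this
      obtain ⟨y', rfl⟩ := Ideal.mem_span_singleton'.mp (witt_mem_span_p p hT h0)
      have : y' * WittVector.teichmuller p a = p ^ k * z :=
        witt_p_mul_cancel hT (by linear_combination hz)
      rw [pow_succ]
      exact mul_dvd_mul (ih _ (Dvd.intro z this.symm)) dvd_rfl

end Witt

/-! ### The ideal of Witt vectors with coefficients in `Ann(a)` -/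

section Annihilator

variable {p} {T T' : Type u} [CommRing T] [CommRing T'] {a : T} {f : T →+* T'}

theorem regular_of_ker_eq_annihilator (hT : IsPerfect p T) (hf : Function.Surjective f)
    (hker : ∀ x, f x = 0 ↔ a * x = 0) (y : T') (hy : f a * y = 0) : y = 0 := by
  obtain ⟨x, rfl⟩ := hf y
  rw [← map_mul, hker] at hy
  exact (hker _).mpr (hT.mul_eq_zero_of_sq_mul hy)

theorem isPerfect_of_ker_eq_annihilator (hT : IsPerfect p T) (hf : Function.Surjective f)
    (hker : ∀ x, f x = 0 ↔ a * x = 0) : IsPerfect p T' := by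
  refine hT.of_surjective f hf fun x hx => ?_
  rw [hker] at hx ⊢
  exact hT.mul_eq_zero_of_mul_pow (Fact.out : p.Prime).ne_zero hx

/-- The coefficients of `[a] w` vanish in `T'` and in `T/(a)`, so they lie in `Ann(a) ∩ (a)`. This
intersection is zero, since `x = c a` and `a x = 0` give `x² = c a x = 0`. -/
theorem teichmuller_mul_eq_zero (hT : IsPerfect p T) (hker : ∀ x, f x = 0 ↔ a * x = 0)
    {w : WittVector p T} (hw : WittVector.map f w = 0) :
    WittVector.teichmuller p a * w = 0 := by
  have h1 : WittVector.map f (WittVector.teichmuller p a * w) = 0 := by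
    rw [map_mul, hw, mul_zero]
  have h2 : WittVector.map (Ideal.Quotient.mk (Ideal.span {a}))
      (WittVector.teichmuller p a * w) = 0 := by
    rw [map_mul, WittVector.map_teichmuller, Ideal.Quotient.eq_zero_iff_mem.mpr
      (Ideal.mem_span_singleton_self a), WittVector.teichmuller_zero, zero_mul]
  rw [witt_map_eq_zero_iff] at h1 h2
  ext n
  have h1 := (hker _).mp (h1 n)
  obtain ⟨c, hc⟩ := Ideal.mem_span_singleton'.mp (Ideal.Quotient.eq_zero_iff_mem.mp (h2 n))
  rw [WittVector.zero_coeff]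
  refine hT.eq_zero_of_pow_eq_zero (n := 2) ?_
  nth_rewrite 1 [pow_two, ← hc]
  linear_combination c * h1

end Annihilator

end PerfdAcris

namespace PerfdAcris

variable (p : ℕ) [Fact p.Prime]

/-! ### The divided power envelope of `(p, [a])` in `W(T)` -/

section WittEnvelope

variable {p} {T : Type u} [CommRing T] (hp : (p : T) = 0) (J : Ideal (WittVector p T)) {a : T}

/-- The divided power envelope of an ideal `J` of `W(T)` relative to `pℤ_p`. -/
abbrev WittEnvelope : Type u := PDEnvelope (PadicInt.dividedPowers p) (padicToWitt p hp) J

/-- The structure map from `W(T)` to the divided power envelope. -/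
abbrev wittOf : WittVector p T →+* WittEnvelope hp J :=
  PDEnvelope.of (PadicInt.dividedPowers p) (padicToWitt p hp) J

/-- The divided powers of the divided power envelope of `J ⊆ W(T)`. -/
abbrev wittEnvelopeDP :=
  PDEnvelope.dividedPowers (PadicInt.dividedPowers p) (padicToWitt p hp) J

/-- The divided power `γ_n([a])`. -/
def teichGamma (a : T) (n : ℕ) : WittEnvelope hp J :=
  (wittEnvelopeDP hp J).dpow n (wittOf hp J (WittVector.teichmuller p a))

variable {J} (hJ : ∀ x, x ∈ J ↔ ∃ t, x.coeff 0 = a * t)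

include hJ in
theorem teichmuller_mem : WittVector.teichmuller p a ∈ J :=
  (hJ _).mpr ⟨1, by simp⟩

include hp hJ in
theorem natCast_p_mem : (p : WittVector p T) ∈ J :=
  (hJ _).mpr ⟨0, by rw [witt_coeff_zero_natCast_p hp, mul_zero]⟩

include hJ in
theorem map_padicToWitt_le : (Ideal.span {(p : ℤ_[p])}).map (padicToWitt p hp) ≤ J := by
  rw [Ideal.map_span, Set.image_singleton, map_natCast, Ideal.span_singleton_le_iff_mem]
  exact natCast_p_mem hp hJ

include hJ in
theorem wittOf_teichmuller_mem :
    wittOf hp J (WittVector.teichmuller p a) ∈ PDEnvelope.pdIdeal _ _ J :=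
  PDEnvelope.of_mem _ _ J (teichmuller_mem hJ)

include hJ in
theorem teichGamma_zero : teichGamma hp J a 0 = 1 :=
  (wittEnvelopeDP hp J).dpow_zero (wittOf_teichmuller_mem hp hJ)

include hJ in
theorem teichGamma_mul (m n : ℕ) : teichGamma hp J a m * teichGamma hp J a n =
    ((m + n).choose m : ℕ) * teichGamma hp J a (m + n) :=
  (wittEnvelopeDP hp J).mul_dpow (wittOf_teichmuller_mem hp hJ)

include hJ in
theorem natCast_mul_teichGamma_succ (n : ℕ) : ((n + 1 : ℕ) : WittEnvelope hp J) *
    teichGamma hp J a (n + 1) =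
    wittOf hp J (WittVector.teichmuller p a) * teichGamma hp J a n := by
  have h := teichGamma_mul hp hJ 1 n
  have h1 : teichGamma hp J a 1 = wittOf hp J (WittVector.teichmuller p a) :=
    (wittEnvelopeDP hp J).dpow_one (wittOf_teichmuller_mem hp hJ)
  rw [h1, Nat.choose_one_right, add_comm 1 n] at h
  exact h.symm

include hJ in
theorem factorial_mul_teichGamma (n : ℕ) : ((n.factorial : ℕ) : WittEnvelope hp J) *
    teichGamma hp J a n = wittOf hp J (WittVector.teichmuller p a ^ n) := by
  rw [map_pow]
  exact (wittEnvelopeDP hp J).factorial_mul_dpow_eq_pow (wittOf_teichmuller_mem hp hJ)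

include hJ in
/-- The divided powers of `p u + [a] v` are combinations of the `γ_n([a])`, and so every element
of the envelope is one. -/
theorem exists_eq_sum_teichGamma (hT : IsPerfect p T) (d : WittEnvelope hp J) :
    ∃ (N : ℕ) (w : ℕ → WittVector p T),
      d = ∑ n ∈ Finset.range (N + 1), wittOf hp J (w n) * teichGamma hp J a n := by
  let : Algebra (WittVector p T) (WittEnvelope hp J) := (wittOf hp J).toAlgebra
  have hsmul : ∀ (w : WittVector p T) (d : WittEnvelope hp J), w • d = wittOf hp J w * d :=
    fun w d => Algebra.smul_def w d
  let M : Submodule (WittVector p T) (WittEnvelope hp J) :=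
    Submodule.span _ (Set.range (teichGamma hp J a))
  have hg : ∀ n, teichGamma hp J a n ∈ M := fun n => Submodule.subset_span ⟨n, rfl⟩
  have hof : ∀ w, wittOf hp J w ∈ M := fun w => by
    have := M.smul_mem w (hg 0)
    rwa [hsmul, teichGamma_zero hp hJ, mul_one] at this
  have hmul : ∀ x ∈ M, ∀ y ∈ M, x * y ∈ M := by
    intro x hx y hy
    have h : M * M ≤ M := by
      rw [Submodule.span_mul_span, Submodule.span_le]
      rintro _ ⟨_, ⟨m, rfl⟩, _, ⟨n, rfl⟩, rfl⟩
      have := M.smul_mem (((m + n).choose m : ℕ) : WittVector p T) (hg (m + n))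
      rw [hsmul, map_natCast] at this
      change teichGamma hp J a m * teichGamma hp J a n ∈ M
      rwa [teichGamma_mul hp hJ]
    exact h (Submodule.mul_mem_mul hx hy)
  have hp1 : (p : ℤ_[p]) ∈ Ideal.span {(p : ℤ_[p])} := Ideal.mem_span_singleton_self _
  -- Compatibility with the divided powers of `pℤ_p` puts `γ_n(p)` in the image of `ℤ_p`.
  have hgp : ∀ n, (wittEnvelopeDP hp J).dpow n (wittOf hp J p) ∈ M := by
    intro n
    have := (PDEnvelope.isPDTarget (PadicInt.dividedPowers p) _ J
      (map_padicToWitt_le hp hJ)).compat.dpow_comp (n := n) p hp1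
    rw [RingHom.comp_apply, RingHom.comp_apply, map_natCast] at this
    rw [this]
    exact hof _
  have hgamma : ∀ (n : ℕ) (x : J), PDEnvelope.gamma _ (padicToWitt p hp) J n x ∈ M := by
    intro n x
    obtain ⟨t, ht⟩ := (hJ _).mp x.2
    -- Every `x ∈ J` is `u p + [t][a]`, and the addition formula reduces `γ_n(x)` to the `γ_i(p)`
    -- and `γ_j([a])`.
    have h0 : (x.1 - WittVector.teichmuller p t * WittVector.teichmuller p a).coeff 0 = 0 := by
      change WittVector.constantCoeff
        (x.1 - WittVector.teichmuller p t * WittVector.teichmuller p a) = 0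
      rw [map_sub, map_mul]
      simp [ht, mul_comm]
    obtain ⟨u, hu⟩ := Ideal.mem_span_singleton'.mp (witt_mem_span_p p hT h0)
    have hx : wittOf hp J x.1 = wittOf hp J u * wittOf hp J p +
        wittOf hp J (WittVector.teichmuller p t) * wittOf hp J (WittVector.teichmuller p a) := by
      rw [← map_mul, ← map_mul, ← map_add, hu, sub_add_cancel]
    have hpm := PDEnvelope.of_mem (PadicInt.dividedPowers p) (padicToWitt p hp) J
      (natCast_p_mem hp hJ)
    rw [← PDEnvelope.dpow_of, hx, (wittEnvelopeDP hp J).dpow_add (Ideal.mul_mem_left _ _ hpm)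
      (Ideal.mul_mem_left _ _ (wittOf_teichmuller_mem hp hJ))]
    refine M.sum_mem fun k _ => ?_
    rw [(wittEnvelopeDP hp J).dpow_mul hpm,
      (wittEnvelopeDP hp J).dpow_mul (wittOf_teichmuller_mem hp hJ), ← map_pow, ← map_pow]
    exact hmul _ (hmul _ (hof _) _ (hgp _)) _ (hmul _ (hof _) _ (hg _))
  have hd : d ∈ M := by
    obtain ⟨f, rfl⟩ := PDEnvelope.mk_surjective _ _ J d
    induction f using MvPolynomial.induction_on with
    | C w => exact hof w
    | add f g hf hg =>
      rw [map_add]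
      exact M.add_mem hf hg
    | mul_X f i hf =>
      rw [map_mul]
      exact hmul _ hf _ (hgamma i.1 i.2)
  obtain ⟨c, hc⟩ := Finsupp.mem_span_range_iff_exists_finsupp.mp hd
  refine ⟨c.support.sup id, c, ?_⟩
  rw [← hc]
  refine (Finsupp.sum_of_support_subset c (s := Finset.range (c.support.sup id + 1)) ?_ _
    (fun i _ => zero_smul (WittVector p T) (teichGamma hp J a i))).trans ?_
  rotate_left
  · exact Finset.sum_congr rfl fun n _ => hsmul _ _
  · intro n hn
    exact Finset.mem_range.mpr (Nat.lt_succ_of_le (Finset.le_sup (f := id) hn))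

section Annihilator

variable {T' : Type u} [CommRing T'] {f : T →+* T'} (hker : ∀ x, f x = 0 ↔ a * x = 0)

include hJ hker in
-- Write `t = s ^ p ^ n`; then `s` also lies in `Ann(a)`. As `n ≤ p ^ n`, the factor `[s] ^ n` can
-- be split off `[t]`, and `[s] ^ n γ_n([a]) = γ_n([s a]) = γ_n(0) = 0`.
theorem wittOf_teichmuller_mul_teichGamma (hT : IsPerfect p T) {t : T} (ht : f t = 0) {n : ℕ}
    (hn : n ≠ 0) :
    wittOf hp J (WittVector.teichmuller p t) * teichGamma hp J a n = 0 := by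
  obtain ⟨s, rfl⟩ := hT.pow_surjective n t
  have hle : n ≤ p ^ n := (Nat.lt_pow_self (Fact.out : p.Prime).one_lt).le
  rw [hker] at ht
  have has := hT.mul_eq_zero_of_mul_pow (pow_ne_zero _ (Fact.out : p.Prime).ne_zero) ht
  obtain ⟨m, hm⟩ := Nat.exists_eq_add_of_le' hle
  change wittOf hp J (WittVector.teichmuller p (s ^ p ^ n)) * _ = 0
  rw [hm, map_pow, pow_add, map_mul, mul_assoc, map_pow (wittOf hp J) _ n, teichGamma,
    ← (wittEnvelopeDP hp J).dpow_mul (wittOf_teichmuller_mem hp hJ), ← map_mul, ← map_mul,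
    mul_comm s, has, WittVector.teichmuller_zero, map_zero, (wittEnvelopeDP hp J).dpow_eval_zero hn,
    mul_zero]

include hJ hker in
-- Modulo Teichmüller elements of `Ann(a)`, which kill `γ_n([a])`, the vector `w` may be replaced by
-- a multiple `p ^ k w'` with `w'` of the same kind. When `p ^ k` is associated to `n!`, the product
-- becomes a multiple of `w' [a] ^ n`, which is zero because `[a] w' = 0`.
theorem wittOf_mul_teichGamma (hT : IsPerfect p T) (hT' : IsPerfect p T') {w : WittVector p T}
    (hw : WittVector.map f w = 0) {n : ℕ} (hn : n ≠ 0) :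
    wittOf hp J w * teichGamma hp J a n = 0 := by
  have key : ∀ k : ℕ, ∃ w', WittVector.map f w' = 0 ∧
      wittOf hp J w * teichGamma hp J a n = wittOf hp J ((p : WittVector p T) ^ k * w') * teichGamma hp J a n := by
    intro k
    induction k with
    | zero => exact ⟨w, hw, by rw [pow_zero, one_mul]⟩
    | succ k ih =>
      obtain ⟨w', hw', h⟩ := ih
      obtain ⟨w'', h''⟩ := witt_exists_add_p_mul hT w'
      have h0 : f (w'.coeff 0) = 0 := (witt_map_eq_zero_iff f).mp hw' 0
      refine ⟨w'', ?_, ?_⟩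
      -- The remainder `w''` is again in the kernel because `W(T')` is `p`-torsion free.
      · refine witt_p_mul_cancel hT' ?_
        have := hw'
        rw [h'', map_add, WittVector.map_teichmuller, h0, WittVector.teichmuller_zero, zero_add,
          map_mul, map_natCast] at this
        rw [this, mul_zero]
      · rw [h, h'', mul_add, map_add, add_mul, map_mul, mul_assoc,
          wittOf_teichmuller_mul_teichGamma hp hJ hker hT h0 hn, mul_zero, zero_add, ← mul_assoc,
          ← pow_succ]
  obtain ⟨k, u, hu⟩ := witt_natCast_associated hT.p_eq_zero n.factorial_ne_zero
  obtain ⟨w', hw', h⟩ := key k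
  have h2 : (p : WittVector p T) ^ k = n.factorial * (↑u⁻¹ : WittVector p T) := by
    rw [← hu, mul_assoc, Units.mul_inv, mul_one]
  obtain ⟨m, rfl⟩ := Nat.exists_eq_succ_of_ne_zero hn
  have h3 := factorial_mul_teichGamma hp hJ m.succ
  rw [h, h2, map_mul, map_mul, map_natCast]
  calc _ = wittOf hp J ↑u⁻¹ * wittOf hp J w' *
        (((m.succ.factorial : ℕ) : WittEnvelope hp J) * teichGamma hp J a m.succ) := by ring
    _ = wittOf hp J (↑u⁻¹ * (WittVector.teichmuller p a ^ m *
          (WittVector.teichmuller p a * w'))) := by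
        rw [h3, ← map_mul, ← map_mul]
        congr 1
        rw [Nat.succ_eq_add_one]
        ring
    _ = 0 := by rw [teichmuller_mul_eq_zero hT hker hw', mul_zero, mul_zero, map_zero]

end Annihilator

end WittEnvelope

end PerfdAcris

namespace PerfdAcris

variable (p : ℕ) [Fact p.Prime]

/-! ### The divided power envelope and the total fraction ring of `W(T')` -/

section Fraction

variable {p} {T' : Type u} [CommRing T'] (hT' : IsPerfect p T')

include hT' in
theorem isUnit_natCast_fractionRing {n : ℕ} (hn : n ≠ 0) :
    IsUnit (n : FractionRing (WittVector p T')) := by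
  have h : (n : WittVector p T') ∈ nonZeroDivisors (WittVector p T') := by
    rw [mem_nonZeroDivisors_iff_right]
    intro x hx
    exact witt_natCast_mul_cancel hT' hn (by rw [mul_comm, hx, mul_zero])
  have := IsLocalization.map_units (FractionRing (WittVector p T')) ⟨_, h⟩
  rwa [map_natCast] at this

/-- The `ℚ`-algebra structure on the total fraction ring of `W(T')` for `T'` perfect. -/
def ratToFractionRing : ℚ →+* FractionRing (WittVector p T') :=
  IsLocalization.lift (M := nonZeroDivisors ℤ)
    (g := Int.castRingHom (FractionRing (WittVector p T'))) (by
      intro y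
      have hy : (y : ℤ).natAbs ≠ 0 := Int.natAbs_ne_zero.mpr (nonZeroDivisors.coe_ne_zero y)
      have h := isUnit_natCast_fractionRing hT' hy
      rw [eq_intCast]
      rcases Int.natAbs_eq (y : ℤ) with h' | h'
      · rw [h', Int.cast_natCast]
        exact h
      · rw [h', Int.cast_neg, Int.cast_natCast]
        exact h.neg)

open Classical in
/-- The divided powers `x ^ n / n!` on the total fraction ring of `W(T')` for `T'` perfect. -/
def fractionDividedPowers : DividedPowers (⊤ : Ideal (FractionRing (WittVector p T'))) :=
  letI : Algebra ℚ (FractionRing (WittVector p T')) := (ratToFractionRing hT').toAlgebra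
  DividedPowers.RatAlgebra.dividedPowers ⊤

variable {T : Type u} [CommRing T] (hp : (p : T) = 0) (J : Ideal (WittVector p T))

/-- The divided power ideal is the whole ring, so both inclusions are automatic. Compatibility
follows by cancelling the invertible element `n!`. -/
theorem isPDTarget_fraction (f : T →+* T') :
    IsPDTarget (PadicInt.dividedPowers p) (padicToWitt p hp) J (fractionDividedPowers hT')
      ((algebraMap (WittVector p T') (FractionRing (WittVector p T'))).comp
        (WittVector.map f)) := by
  refine ⟨le_top, le_top, fun {n} x hx => ?_⟩
  refine (isUnit_natCast_fractionRing hT' n.factorial_ne_zero).mul_left_cancel ?_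
  rw [(fractionDividedPowers hT').factorial_mul_dpow_eq_pow trivial, ← map_pow,
    ← DividedPowers.factorial_mul_dpow_eq_pow (PadicInt.dividedPowers p) hx, map_mul, map_natCast]

/-- The ring homomorphism from the divided power envelope to the total fraction ring of `W(T')`. -/
abbrev toFraction (f : T →+* T') : WittEnvelope hp J →+* FractionRing (WittVector p T') :=
  PDEnvelope.lift (isPDTarget_fraction hT' hp J f)

variable {J} {a : T} (hJ : ∀ x, x ∈ J ↔ ∃ t, x.coeff 0 = a * t)
  {f : T →+* T'}

include hJ in
theorem factorial_mul_toFraction_teichGamma (n : ℕ) :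
    (n.factorial : FractionRing (WittVector p T')) *
      toFraction hT' hp J f (teichGamma hp J a n) =
    algebraMap _ _ (WittVector.teichmuller p (f a) ^ n) := by
  have := congrArg (toFraction hT' hp J f) (factorial_mul_teichGamma hp hJ n)
  rw [map_mul, map_natCast, PDEnvelope.lift_of, RingHom.comp_apply, map_pow (WittVector.map f),
    WittVector.map_teichmuller] at this
  exact this

include hJ in
/-- Let `f : T → T'` be surjective with kernel `Ann(a)`. The kernel of the homomorphism from the
divided power envelope of `(p, [a])` to `W(T')[1/p]` is the image of `W(Ann(a))`. -/
theorem exists_eq_wittOf_of_toFraction_eq_zero (hT : IsPerfect p T) (hf : Function.Surjective f)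
    (hker : ∀ x, f x = 0 ↔ a * x = 0) {d : WittEnvelope hp J}
    (hd : toFraction hT' hp J f d = 0) :
    ∃ v, WittVector.map f v = 0 ∧ d = wittOf hp J v := by
  obtain ⟨N, w, rfl⟩ := exists_eq_sum_teichGamma hp hJ hT d
  have hinj := IsFractionRing.injective (WittVector p T') (FractionRing (WittVector p T'))
  have hof : ∀ w, toFraction hT' hp J f (wittOf hp J w) =
      algebraMap _ _ (WittVector.map f w) := fun w => PDEnvelope.lift_of _ w
  induction N generalizing w with
  | zero =>
    rw [zero_add, Finset.sum_range_one, teichGamma_zero hp hJ, mul_one] at hd ⊢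
    rw [hof] at hd
    exact ⟨w 0, hinj (by rw [hd, map_zero]), rfl⟩
  | succ N ih =>
    -- Multiply the relation by `(N + 1)!`. The top term becomes `w_{N+1} [a] ^ (N + 1)`. Each lower
    -- term is already integral after multiplication by `N!`, so it acquires the factor `N + 1`.
    have hdvd : ((N + 1 : ℕ) : WittVector p T') ∣
        WittVector.map f (w (N + 1)) * WittVector.teichmuller p (f a) ^ (N + 1) := by
      have hint : ∀ n ∈ Finset.range (N + 1), ∃ z : WittVector p T',
          (N.factorial : FractionRing (WittVector p T')) * toFraction hT' hp J f
            (wittOf hp J (w n) * teichGamma hp J a n) = algebraMap _ _ z := by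
        intro n hn
        obtain ⟨c, hc⟩ := Nat.factorial_dvd_factorial (Nat.lt_succ_iff.mp (Finset.mem_range.mp hn))
        refine ⟨WittVector.map f (w n) * (c * WittVector.teichmuller p (f a) ^ n), ?_⟩
        rw [map_mul, hof, hc, Nat.cast_mul, map_mul, map_mul, map_natCast,
          ← factorial_mul_toFraction_teichGamma hT' hp hJ]
        ring
      choose! z hz using hint
      have h := congrArg (fun x => ((N + 1).factorial : FractionRing (WittVector p T')) * x) hd
      rw [mul_zero, Finset.sum_range_succ, map_add, mul_add, map_mul, mul_left_comm,
        factorial_mul_toFraction_teichGamma hT' hp hJ, hof, map_sum, Nat.factorial_succ,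
        Nat.cast_mul, mul_assoc, Finset.mul_sum, Finset.sum_congr rfl hz, ← map_natCast
        (algebraMap (WittVector p T') _), ← map_sum, ← map_mul, ← map_mul, ← map_add] at h
      have h := hinj (h.trans (map_zero _).symm)
      exact Dvd.intro (-(∑ n ∈ Finset.range (N + 1), z n)) (by linear_combination -h)
    have hreg := regular_of_ker_eq_annihilator hT hf hker
    obtain ⟨y, hy⟩ := witt_dvd_of_dvd_mul_teichmuller_pow hT' hreg N.succ_ne_zero _ hdvd
    obtain ⟨y, rfl⟩ := WittVector.map_surjective f hf y
    -- Thus `w_{N+1} = (N + 1) y` up to an element of `W(Ann(a))`, which kills `γ_{N+1}([a])`. The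
    -- top term is therefore `y [a] γ_N([a])` and is absorbed into the coefficient of index `N`.
    have hw : WittVector.map f (w (N + 1) - ((N + 1 : ℕ) : WittVector p T) * y) = 0 := by
      rw [map_sub, map_mul, map_natCast, hy, sub_self]
    have hlast : wittOf hp J (w (N + 1)) * teichGamma hp J a (N + 1) =
        wittOf hp J (y * WittVector.teichmuller p a) * teichGamma hp J a N := by
      have h0 := wittOf_mul_teichGamma hp hJ hker hT hT' hw N.succ_ne_zero
      have h1 := natCast_mul_teichGamma_succ hp hJ N
      rw [map_sub, map_mul, map_natCast] at h0
      rw [map_mul]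
      linear_combination h0 + wittOf hp J y * h1
    have hsum : ∑ n ∈ Finset.range (N + 1 + 1), wittOf hp J (w n) * teichGamma hp J a n =
        ∑ n ∈ Finset.range (N + 1), wittOf hp J (Function.update w N
          (w N + y * WittVector.teichmuller p a) n) * teichGamma hp J a n := by
      rw [Finset.sum_range_succ, hlast, Finset.sum_range_succ, Finset.sum_range_succ,
        Function.update_self, map_add, add_mul, add_assoc]
      congr 1
      refine Finset.sum_congr rfl fun n hn => ?_
      rw [Function.update_of_ne (Finset.mem_range.mp hn).ne]
    rw [hsum] at hd ⊢
    exact ih _ hd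

include hJ in
-- For regular `a` the kernel description applies to `f = id` and makes `toFraction` injective; `p`
-- is invertible in its target.
theorem wittEnvelope_isTorsionFree (hT : IsPerfect p T) (ha : ∀ x, a * x = 0 → x = 0) :
    IsTorsionFree p (WittEnvelope hp J) := by
  intro d hd
  have h : toFraction hT hp J (RingHom.id T) d = 0 := by
    refine (isUnit_natCast_fractionRing hT (Fact.out : p.Prime).ne_zero).mul_left_cancel ?_
    rw [← map_natCast (toFraction hT hp J (RingHom.id T)), ← map_mul, hd, map_zero, mul_zero]
  obtain ⟨v, hv, rfl⟩ := exists_eq_wittOf_of_toFraction_eq_zero hT hp hJ hT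
    (f := RingHom.id T) Function.surjective_id
    (fun x => ⟨fun hx => by rw [show x = 0 from hx, mul_zero], ha x⟩) h
  have : v = 0 := by
    ext n
    rw [WittVector.zero_coeff]
    exact (witt_map_eq_zero_iff _).mp hv n
  rw [this, map_zero]

variable (hp' : (p : T') = 0) {J' : Ideal (WittVector p T')}
  (hJ' : ∀ x, x ∈ J' ↔ ∃ t, x.coeff 0 = f a * t)
  (h : IsPDTarget (PadicInt.dividedPowers p) (padicToWitt p hp) J (wittEnvelopeDP hp' J')
    ((wittOf hp' J').comp (WittVector.map f)))

/-- Through this factorization, whatever dies in the envelope over `T'` also dies in the total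
fraction ring of `W(T')`, where the kernel is known. -/
theorem toFraction_lift (d : WittEnvelope hp J) :
    toFraction hT' hp' J' (RingHom.id T') (PDEnvelope.lift h d) = toFraction hT' hp J f d := by
  have hid : ∀ x : WittVector p T', WittVector.map (RingHom.id T') x = x := fun x => by
    ext n
    simp
  have : (toFraction hT' hp' J' (RingHom.id T')).comp (PDEnvelope.lift h) =
      toFraction hT' hp J f := by
    refine Ideal.Quotient.ringHom_ext (MvPolynomial.ringHom_ext (fun b => ?_) ?_)
    · change toFraction hT' hp' J' (RingHom.id T') (PDEnvelope.lift h (wittOf hp J b)) =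
        toFraction hT' hp J f (wittOf hp J b)
      rw [PDEnvelope.lift_of, PDEnvelope.lift_of, RingHom.comp_apply, PDEnvelope.lift_of,
        RingHom.comp_apply, RingHom.comp_apply, hid]
    · rintro ⟨n, x⟩
      change toFraction hT' hp' J' (RingHom.id T')
        (PDEnvelope.lift h (PDEnvelope.gamma _ _ J n x)) =
        toFraction hT' hp J f (PDEnvelope.gamma _ _ J n x)
      rw [PDEnvelope.lift_gamma, PDEnvelope.lift_gamma]
      refine (PDEnvelope.lift_dpow _ (h.map_le (Ideal.mem_map_of_mem _ x.2)) n).trans ?_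
      rw [RingHom.comp_apply, PDEnvelope.lift_of, RingHom.comp_apply, RingHom.comp_apply, hid]
  exact RingHom.congr_fun this d

include hJ hT' in
theorem exists_eq_wittOf_of_lift_eq_zero (hT : IsPerfect p T) (hf : Function.Surjective f)
    (hker : ∀ x, f x = 0 ↔ a * x = 0) {d : WittEnvelope hp J} (hd : PDEnvelope.lift h d = 0) :
    ∃ v, WittVector.map f v = 0 ∧ d = wittOf hp J v := by
  refine exists_eq_wittOf_of_toFraction_eq_zero hT' hp hJ hT hf hker ?_
  rw [← toFraction_lift hT' hp hp' h, hd, map_zero]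

include hJ hJ' hT' in
-- The target is spanned over `W(T')` by the `γ_n([f a])`, which are images of the `γ_n([a])`; the
-- coefficients lift along `W(T) → W(T')`.
theorem lift_wittEnvelope_surjective (hf : Function.Surjective f) :
    Function.Surjective (PDEnvelope.lift h) := by
  intro d
  obtain ⟨N, w, rfl⟩ := exists_eq_sum_teichGamma hp' hJ' hT' d
  choose w' hw' using fun n => WittVector.map_surjective f hf (w n)
  refine ⟨∑ n ∈ Finset.range (N + 1), wittOf hp J (w' n) * teichGamma hp J a n, ?_⟩
  rw [map_sum]
  refine Finset.sum_congr rfl fun n _ => ?_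
  rw [map_mul, PDEnvelope.lift_of, RingHom.comp_apply, hw']
  congr 1
  refine (PDEnvelope.lift_dpow h (wittOf_teichmuller_mem hp hJ) n).trans ?_
  rw [PDEnvelope.lift_of, RingHom.comp_apply, WittVector.map_teichmuller]
  rfl

end Fraction

end PerfdAcris

namespace PerfdAcris

variable (p : ℕ)

/-! ### Completions of exact sequences -/

section Completion

variable {p} {A B C : Type u} [CommRing A] [CommRing B] [CommRing C]

/-- The `p`-adic completion of `D`. -/
abbrev PCompletion (p : ℕ) (D : Type u) [CommRing D] : Type u :=
  AdicCompletion (Ideal.span {(p : D)}) D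

theorem mem_span_pow_iff {x : A} {n : ℕ} :
    x ∈ Ideal.span {(p : A)} ^ n ↔ ∃ y, x = (p : A) ^ n * y := by
  rw [Ideal.span_singleton_pow, Ideal.mem_span_singleton]
  rfl

theorem IsTorsionFree.pow_mul (hA : IsTorsionFree p A) (n : ℕ) {x : A}
    (h : (p : A) ^ n * x = 0) : x = 0 := by
  induction n with
  | zero => simpa using h
  | succ n ih =>
    refine ih (hA _ ?_)
    rw [← mul_assoc, ← pow_succ', h]

theorem exists_evalₐ_eq_mk (x : PCompletion p A) : ∃ a : ℕ → A,
    (∀ n, AdicCompletion.evalₐ (Ideal.span {(p : A)}) n x = Ideal.Quotient.mk _ (a n)) ∧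
      ∀ n, ∃ c, a (n + 1) - a n = (p : A) ^ n * c := by
  obtain ⟨y, rfl⟩ := AdicCompletion.mk_surjective (Ideal.span {(p : A)}) A x
  refine ⟨y, fun n => by simp, fun n => ?_⟩
  have := AdicCompletion.Ideal.mk_eq_mk (Ideal.span {(p : A)}) n.le_succ y
  rw [Ideal.Quotient.eq] at this
  exact mem_span_pow_iff.mp this

theorem exists_pCompletion (a : ℕ → A) (ha : ∀ n, ∃ c, a (n + 1) - a n = (p : A) ^ n * c) :
    ∃ x : PCompletion p A,
      ∀ n, AdicCompletion.evalₐ (Ideal.span {(p : A)}) n x = Ideal.Quotient.mk _ (a n) := by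
  refine ⟨AdicCompletion.mk _ _ (AdicCompletion.AdicCauchySequence.mk _ _ a fun n => ?_),
    fun n => by simp⟩
  rw [smul_eq_mul, Ideal.mul_top]
  refine (SModEq.sub_mem.mpr (mem_span_pow_iff.mpr ?_)).symm
  exact ha n

theorem evalₐ_completionMap (f : A →+* B) (x : PCompletion p A) {n : ℕ} {a : A}
    (h : AdicCompletion.evalₐ (Ideal.span {(p : A)}) n x = Ideal.Quotient.mk _ a) :
    AdicCompletion.evalₐ (Ideal.span {(p : B)}) n (completionMap p f x) =
      Ideal.Quotient.mk _ (f a) := by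
  refine (AdicCompletion.evalₐ_liftRingHom _ _ (completionMapAux_compat p f) n _).trans ?_
  simp [completionMapAux, h]

theorem pCompletion_isTorsionFree (hA : IsTorsionFree p A) :
    IsTorsionFree p (PCompletion p A) := by
  intro x hx
  obtain ⟨a, ha, hac⟩ := exists_evalₐ_eq_mk x
  refine AdicCompletion.ext_evalₐ fun n => ?_
  -- Cancelling `p` costs one power of `p`, so level `n` is read off from level `n + 1`.
  have h := congrArg (AdicCompletion.evalₐ (Ideal.span {(p : A)}) (n + 1)) hx
  rw [map_mul, map_natCast, ha, map_zero, ← map_natCast (Ideal.Quotient.mk _), ← map_mul,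
    Ideal.Quotient.eq_zero_iff_mem, mem_span_pow_iff] at h
  obtain ⟨c, hc⟩ := h
  obtain ⟨c', hc'⟩ := hac n
  rw [ha, map_zero, Ideal.Quotient.eq_zero_iff_mem, mem_span_pow_iff]
  have h0 := hA (a (n + 1) - p ^ n * c) (by rw [mul_sub, hc]; ring)
  exact ⟨c - c', by linear_combination h0 - hc'⟩

/-- The map from the `p`-adic completion of `A` to a `p`-adically complete ring `B`. -/
def toComplete [IsAdicComplete (Ideal.span {(p : B)}) B] (f : A →+* B) : PCompletion p A →+* B :=
  (AdicCompletion.ofAlgEquiv (Ideal.span {(p : B)})).symm.toRingEquiv.toRingHom.comp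
    (completionMap p f)

theorem mk_toComplete [IsAdicComplete (Ideal.span {(p : B)}) B] (f : A →+* B)
    (x : PCompletion p A) {n : ℕ} {a : A}
    (h : AdicCompletion.evalₐ (Ideal.span {(p : A)}) n x = Ideal.Quotient.mk _ a) :
    ∃ c, toComplete f x - f a = (p : B) ^ n * c := by
  rw [← mem_span_pow_iff, ← Ideal.Quotient.eq, ← evalₐ_completionMap f x h]
  exact AdicCompletion.mk_ofAlgEquiv_symm _ n _

theorem eq_of_forall_sub_eq_pow_mul [IsAdicComplete (Ideal.span {(p : B)}) B] {x y : B}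
    (h : ∀ n, ∃ c, x - y = (p : B) ^ n * c) : x = y := by
  refine sub_eq_zero.mp (IsHausdorff.haus' (I := Ideal.span {(p : B)}) _ fun n => ?_)
  rw [smul_eq_mul, Ideal.mul_top, SModEq.zero]
  exact mem_span_pow_iff.mpr (h n)

variable {B₁ B₂ : Type u} [CommRing B₁] [CommRing B₂]
  [IsAdicComplete (Ideal.span {(p : B₂)}) B₂] [IsAdicComplete (Ideal.span {(p : C)}) C]
  {φ₁ : A →+* B₁} {φ₂ : A →+* B₂} {ψ₁ : B₁ →+* C} {ψ₂ : B₂ →+* C}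

/-- The completion of an exact sequence `0 → A → B₁ × B₂ → C → 0` with `C` torsion free. -/
theorem exact_completion (hC : IsTorsionFree p C)
    (hinj : ∀ a, φ₁ a = 0 → φ₂ a = 0 → a = 0)
    (hcomp : ∀ a, ψ₁ (φ₁ a) = ψ₂ (φ₂ a))
    (hexact : ∀ b₁ b₂, ψ₁ b₁ = ψ₂ b₂ → ∃ a, φ₁ a = b₁ ∧ φ₂ a = b₂)
    (hsurj : ∀ c, ∃ b₁ b₂, c = ψ₁ b₁ - ψ₂ b₂) :
    Function.Injective (fun x : PCompletion p A => (completionMap p φ₁ x, toComplete φ₂ x)) ∧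
    Function.Exact (fun x : PCompletion p A => (completionMap p φ₁ x, toComplete φ₂ x))
      (fun y : PCompletion p B₁ × B₂ => toComplete ψ₁ y.1 - ψ₂ y.2) ∧
    Function.Surjective (fun y : PCompletion p B₁ × B₂ => toComplete ψ₁ y.1 - ψ₂ y.2) := by
  -- Torsion freeness of `C` enters here: it gives `A ∩ p^n (B₁ × B₂) = p^n A`, hence injectivity
  -- modulo `p^n`.
  have hstrict : ∀ n a b₁ b₂, φ₁ a = (p : B₁) ^ n * b₁ → φ₂ a = (p : B₂) ^ n * b₂ →
      ∃ c, a = (p : A) ^ n * c := by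
    intro n a b₁ b₂ h₁ h₂
    have h := hcomp a
    rw [h₁, h₂, map_mul, map_mul, map_pow, map_pow, map_natCast, map_natCast, ← sub_eq_zero,
      ← mul_sub] at h
    obtain ⟨c, rfl, rfl⟩ := hexact b₁ b₂ (sub_eq_zero.mp (hC.pow_mul n h))
    refine ⟨c, sub_eq_zero.mp (hinj _ ?_ ?_)⟩
    · rw [map_sub, h₁, map_mul, map_pow, map_natCast, sub_self]
    · rw [map_sub, h₂, map_mul, map_pow, map_natCast, sub_self]
  refine ⟨?_, ?_, ?_⟩
  · intro x y hxy
    rw [Prod.ext_iff] at hxy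
    have h₁ : completionMap p φ₁ (x - y) = 0 := by rw [map_sub]; exact sub_eq_zero.mpr hxy.1
    have h₂ : toComplete φ₂ (x - y) = 0 := by rw [map_sub]; exact sub_eq_zero.mpr hxy.2
    refine sub_eq_zero.mp (AdicCompletion.ext_evalₐ fun n => ?_)
    obtain ⟨a, ha⟩ := Ideal.Quotient.mk_surjective
      (AdicCompletion.evalₐ (Ideal.span {(p : A)}) n (x - y))
    have e₁ := evalₐ_completionMap φ₁ _ ha.symm
    rw [h₁, map_zero, eq_comm, Ideal.Quotient.eq_zero_iff_mem, mem_span_pow_iff] at e₁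
    obtain ⟨b₁, e₁⟩ := e₁
    obtain ⟨b₂, e₂⟩ := mk_toComplete φ₂ _ ha.symm
    rw [h₂] at e₂
    rw [← ha, map_zero, Ideal.Quotient.eq_zero_iff_mem, mem_span_pow_iff]
    exact hstrict n a b₁ (-b₂) e₁ (by linear_combination -e₂)
  · rintro ⟨x, y⟩
    constructor
    · intro hxy
      have hxy : toComplete ψ₁ x = ψ₂ y := sub_eq_zero.mp hxy
      obtain ⟨b, hb, hbc⟩ := exists_evalₐ_eq_mk x
      -- At level `n` the pair `(b n, y)` is compatible only up to `p^n c` with `c ∈ C`. Writing `c`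
      -- as a difference from `B₁` and `B₂` corrects the pair by multiples of `p^n`, and the
      -- corrected pair comes from `A`.
      have key : ∀ n, ∃ a b₁ b₂, φ₁ a = b n - (p : B₁) ^ n * b₁ ∧
          φ₂ a = y - (p : B₂) ^ n * b₂ := by
        intro n
        obtain ⟨c, hc⟩ := mk_toComplete ψ₁ x (hb n)
        obtain ⟨b₁, b₂, rfl⟩ := hsurj c
        obtain ⟨a, h₁, h₂⟩ := hexact (b n + p ^ n * b₁) (y + p ^ n * b₂) (by
          rw [map_add, map_add, map_mul, map_mul, map_pow, map_pow, map_natCast, map_natCast,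
            ← hxy]
          linear_combination -hc)
        exact ⟨a, -b₁, -b₂, by rw [h₁]; ring, by rw [h₂]; ring⟩
      choose a b₁ b₂ h₁ h₂ using key
      -- The chosen preimages form a Cauchy sequence, since their differences are divisible by `p^n`
      -- in `B₁` and `B₂`, hence in `A`.
      have hac : ∀ n, ∃ c, a (n + 1) - a n = (p : A) ^ n * c := by
        intro n
        obtain ⟨c, hc⟩ := hbc n
        refine hstrict n _ (c - p * b₁ (n + 1) + b₁ n) (-p * b₂ (n + 1) + b₂ n) ?_ ?_
        · rw [map_sub, h₁, h₁]
          linear_combination hc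
        · rw [map_sub, h₂, h₂]
          ring
      obtain ⟨z, hz⟩ := exists_pCompletion a hac
      refine ⟨z, Prod.ext (AdicCompletion.ext_evalₐ fun n => ?_)
        (eq_of_forall_sub_eq_pow_mul (p := p) fun n => ?_)⟩
      · refine (evalₐ_completionMap φ₁ z (hz n)).trans ?_
        rw [hb n, Ideal.Quotient.eq, mem_span_pow_iff]
        exact ⟨-b₁ n, by rw [h₁]; ring⟩
      · obtain ⟨c, hc⟩ := mk_toComplete φ₂ z (hz n)
        exact ⟨c - b₂ n, by linear_combination hc + h₂ n⟩
    · rintro ⟨z, hz⟩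
      rw [Prod.ext_iff] at hz
      obtain ⟨rfl, rfl⟩ := hz
      obtain ⟨a, ha, -⟩ := exists_evalₐ_eq_mk z
      refine sub_eq_zero.mpr (eq_of_forall_sub_eq_pow_mul (p := p) fun n => ?_)
      obtain ⟨c₁, h₁⟩ := mk_toComplete ψ₁ _ (evalₐ_completionMap φ₁ z (ha n))
      obtain ⟨c₂, h₂⟩ := mk_toComplete φ₂ z (ha n)
      have h₂ := congrArg ψ₂ h₂
      rw [map_sub, map_mul, map_pow, map_natCast] at h₂
      exact ⟨c₁ - ψ₂ c₂, by linear_combination h₁ - h₂ + hcomp (a n)⟩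
  · intro c
    obtain ⟨b₁, b₂, rfl⟩ := hsurj c
    refine ⟨(algebraMap B₁ _ b₁, b₂), ?_⟩
    have : toComplete ψ₁ (algebraMap B₁ (PCompletion p B₁) b₁) = ψ₁ b₁ :=
      eq_of_forall_sub_eq_pow_mul (p := p) fun n => mk_toComplete ψ₁ _ (by simp)
    exact congrArg (· - ψ₂ b₂) this

end Completion

end PerfdAcris

namespace PerfdAcris

variable (p : ℕ) [Fact p.Prime]

/-! ### The exact sequence for divided power envelopes -/

section Sequence

variable {p} {T T₁ k₂ k₁₂ : Type u} [CommRing T] [CommRing T₁] [CommRing k₂] [CommRing k₁₂]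
  {hp : (p : T) = 0} {hp₁ : (p : T₁) = 0} {J : Ideal (WittVector p T)}
  {J₁ : Ideal (WittVector p T₁)}

/-- As `n!` is cancellable in `W(k₂)`, the image of `γ_n(x)` is determined by that of `n! γ_n(x) = x
^ n`. -/
theorem wittEnvelope_ringHom_ext (hk : IsPerfect p k₂) {F G : WittEnvelope hp J →+* WittVector p k₂}
    (h : ∀ x, F (wittOf hp J x) = G (wittOf hp J x)) : F = G := by
  refine Ideal.Quotient.ringHom_ext (MvPolynomial.ringHom_ext (fun b => h b) ?_)
  rintro ⟨n, x⟩
  change F (PDEnvelope.gamma _ _ J n x) = G (PDEnvelope.gamma _ _ J n x)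
  have hx := (wittEnvelopeDP hp J).factorial_mul_dpow_eq_pow (n := n)
    (PDEnvelope.of_mem (PadicInt.dividedPowers p) (padicToWitt p hp) J x.2)
  rw [PDEnvelope.dpow_of, ← map_pow] at hx
  have hF := congrArg F hx
  have hG := congrArg G hx
  rw [map_mul, map_natCast] at hF hG
  exact factorial_cancel p hk n (by rw [hF, hG, h])

variable {a : T} {f : T →+* T₁} {g₂ : T →+* k₂} {g₁ : T₁ →+* k₁₂} {q : k₂ →+* k₁₂}
  (hT : IsPerfect p T) (hk₂ : IsPerfect p k₂) (hk₁₂ : IsPerfect p k₁₂)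
  (hJ : ∀ x, x ∈ J ↔ ∃ t, x.coeff 0 = a * t)
  (hJ₁ : ∀ x, x ∈ J₁ ↔ ∃ t, x.coeff 0 = f a * t)
  (h : IsPDTarget (PadicInt.dividedPowers p) (padicToWitt p hp) J (wittEnvelopeDP hp₁ J₁)
    ((wittOf hp₁ J₁).comp (WittVector.map f)))
  (t₂ : IsPDTarget (PadicInt.dividedPowers p) (padicToWitt p hp) J
    (wittDividedPowers p hk₂) (WittVector.map g₂))
  (t₁ : IsPDTarget (PadicInt.dividedPowers p) (padicToWitt p hp₁) J₁
    (wittDividedPowers p hk₁₂) (WittVector.map g₁))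
  (hf : Function.Surjective f) (hker : ∀ x, f x = 0 ↔ a * x = 0)
  (hg : ∀ x, g₁ (f x) = q (g₂ x)) (hcap : ∀ x, a * x = 0 → g₂ x = 0 → x = 0)
  (hqs : Function.Surjective q) (hq : ∀ y, q y = 0 → ∃ x, a * x = 0 ∧ g₂ x = y)

include hT hJ hf hker hcap in
-- The first condition puts `d` in the image of `W(Ann(a))`. The second puts the coefficients in
-- `ker g₂`, which meets `Ann(a)` trivially.
theorem wittEnvelope_lift_injective (d : WittEnvelope hp J) (h₁ : PDEnvelope.lift h d = 0)
    (h₂ : PDEnvelope.lift t₂ d = 0) : d = 0 := by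
  have hT₁ := isPerfect_of_ker_eq_annihilator hT hf hker
  obtain ⟨v, hv, rfl⟩ := exists_eq_wittOf_of_lift_eq_zero hT₁ hp hJ hp₁ h hT hf hker h₁
  rw [PDEnvelope.lift_of] at h₂
  rw [witt_map_eq_zero_iff] at hv h₂
  have : v = 0 := by
    ext n
    rw [WittVector.zero_coeff]
    exact hcap _ ((hker _).mp (hv n)) (h₂ n)
  rw [this, map_zero]

include hg in
theorem wittEnvelope_lift_comp (d : WittEnvelope hp J) :
    PDEnvelope.lift t₁ (PDEnvelope.lift h d) = WittVector.map q (PDEnvelope.lift t₂ d) := by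
  have : (PDEnvelope.lift t₁).comp (PDEnvelope.lift h) =
      (WittVector.map q).comp (PDEnvelope.lift t₂) := by
    refine wittEnvelope_ringHom_ext hk₁₂ fun x => ?_
    simp only [RingHom.comp_apply, PDEnvelope.lift_of]
    ext n
    simp only [WittVector.map_coeff]
    exact hg _
  exact RingHom.congr_fun this d

include hT hJ hJ₁ hf hker hg hq in
-- Lift `d₁` to `D`. The discrepancy with `y` has coefficients in `ker q`, which lift to `Ann(a)`
-- one by one. Subtracting the resulting Witt vector corrects the second component and leaves the
-- first unchanged.
theorem wittEnvelope_lift_exact (d₁ : WittEnvelope hp₁ J₁) (y : WittVector p k₂)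
    (hy : PDEnvelope.lift t₁ d₁ = WittVector.map q y) :
    ∃ d, PDEnvelope.lift h d = d₁ ∧ PDEnvelope.lift t₂ d = y := by
  have hT₁ := isPerfect_of_ker_eq_annihilator hT hf hker
  obtain ⟨d, rfl⟩ := lift_wittEnvelope_surjective hT₁ hp hJ hp₁ hJ₁ h hf d₁
  rw [wittEnvelope_lift_comp hk₂ hk₁₂ h t₂ t₁ hg, ← sub_eq_zero, ← map_sub,
    witt_map_eq_zero_iff] at hy
  choose w hw₁ hw₂ using fun n => hq _ (hy n)
  refine ⟨d - wittOf hp J (WittVector.mk p w), ?_, ?_⟩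
  · have hw : WittVector.map f (WittVector.mk p w) = 0 :=
      (witt_map_eq_zero_iff f).mpr fun n => (hker _).mpr (hw₁ n)
    rw [map_sub, PDEnvelope.lift_of, RingHom.comp_apply, hw, map_zero, sub_zero]
  · have hw : WittVector.map g₂ (WittVector.mk p w) = PDEnvelope.lift t₂ d - y := by
      ext n
      exact hw₂ n
    rw [map_sub, PDEnvelope.lift_of, hw, sub_sub_cancel]

include hT hJ hJ₁ hf hker hcap t₂ h in
theorem wittEnvelope_isTorsionFree_of_sequence : IsTorsionFree p (WittEnvelope hp J) := by
  intro d hd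
  have hT₁ := isPerfect_of_ker_eq_annihilator hT hf hker
  refine wittEnvelope_lift_injective hT hk₂ hJ h t₂ hf hker hcap d ?_ ?_
  · refine wittEnvelope_isTorsionFree hp₁ hJ₁ hT₁ (regular_of_ker_eq_annihilator hT hf hker) _ ?_
    rw [← map_natCast (PDEnvelope.lift h), ← map_mul, hd, map_zero]
  · refine witt_isTorsionFree p hk₂ _ ?_
    have := congrArg (PDEnvelope.lift t₂) hd
    rwa [map_mul, map_natCast, map_zero] at this

include hT hJ hJ₁ hf hker hg hcap hqs hq in
theorem wittEnvelope_completion_exact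
    [IsAdicComplete (Ideal.span {(p : WittVector p k₂)}) (WittVector p k₂)]
    [IsAdicComplete (Ideal.span {(p : WittVector p k₁₂)}) (WittVector p k₁₂)] :
    Function.Injective (fun x : PCompletion p (WittEnvelope hp J) =>
      (completionMap p (PDEnvelope.lift h) x, toComplete (PDEnvelope.lift t₂) x)) ∧
    Function.Exact (fun x : PCompletion p (WittEnvelope hp J) =>
      (completionMap p (PDEnvelope.lift h) x, toComplete (PDEnvelope.lift t₂) x))
      (fun y : PCompletion p (WittEnvelope hp₁ J₁) × WittVector p k₂ =>
        toComplete (PDEnvelope.lift t₁) y.1 - WittVector.map q y.2) ∧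
    Function.Surjective (fun y : PCompletion p (WittEnvelope hp₁ J₁) × WittVector p k₂ =>
      toComplete (PDEnvelope.lift t₁) y.1 - WittVector.map q y.2) := by
  refine exact_completion (witt_isTorsionFree p hk₁₂)
    (wittEnvelope_lift_injective hT hk₂ hJ h t₂ hf hker hcap)
    (wittEnvelope_lift_comp hk₂ hk₁₂ h t₂ t₁ hg)
    (wittEnvelope_lift_exact hT hk₂ hk₁₂ hJ hJ₁ h t₂ t₁ hf hker hg hq) fun c => ?_
  obtain ⟨c', rfl⟩ := WittVector.map_surjective q hqs c
  exact ⟨0, -c', by rw [map_zero, map_neg, sub_neg_eq_add, zero_add]⟩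

end Sequence

end PerfdAcris

namespace PerfdAcris

variable (p : ℕ) [Fact p.Prime]

/-! ### The rings `S₁`, `S₂` and `S₁₂` -/

section Quotients

variable {p} {S : Type u} [CommRing S] {a : S}

theorem mk_S₁_eq_zero_iff {x : S} : algebraMap S (S₁ a) x = 0 ↔ a * x = 0 := by
  refine Ideal.Quotient.eq_zero_iff_mem.trans ?_
  rw [Ideal.span, Submodule.mem_annihilator_span_singleton, smul_eq_mul, mul_comm]

theorem S₁_surjective : Function.Surjective (algebraMap S (S₁ a)) :=
  Ideal.Quotient.mk_surjective

omit [Fact p.Prime] in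
theorem S₂_surjective : Function.Surjective (algebraMap S (S₂ p a)) :=
  Ideal.Quotient.mk_surjective

theorem isPerfect_S₁ (hS : IsPerfect p S) : IsPerfect p (S₁ a) :=
  isPerfect_of_ker_eq_annihilator hS S₁_surjective fun _ => mk_S₁_eq_zero_iff

/-- Since `p`-power roots are unique in `S`, the ideals `(a^{1/p^n})` form an increasing chain,
whose union is the root ideal. -/
theorem mem_rootIdeal_iff (hS : IsPerfect p S) {x : S} :
    x ∈ rootIdeal p a ↔ ∃ n b c, b ^ p ^ n = a ∧ x = c * b := by
  constructor
  · intro hx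
    induction hx using Submodule.span_induction with
    | mem x hx =>
      obtain ⟨n, hn⟩ := hx
      exact ⟨n, x, 1, hn, (one_mul x).symm⟩
    | zero => exact ⟨0, a, 0, by simp, (zero_mul a).symm⟩
    | add x y _ _ hx hy =>
      obtain ⟨n, b, c, hb, rfl⟩ := hx
      obtain ⟨m, b', c', hb', rfl⟩ := hy
      obtain ⟨d, hd⟩ := hS.pow_surjective (n + m) a
      have h1 : d ^ p ^ m = b := by
        refine hS.pow_injective n ?_
        change (d ^ p ^ m) ^ p ^ n = b ^ p ^ n
        rw [hb, ← hd, ← pow_mul, ← pow_add, add_comm]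
      have h2 : d ^ p ^ n = b' := by
        refine hS.pow_injective m ?_
        change (d ^ p ^ n) ^ p ^ m = b' ^ p ^ m
        rw [hb', ← hd, ← pow_mul, ← pow_add]
      have hp : ∀ k, p ^ k ≠ 0 := fun k => pow_ne_zero _ (Fact.out : p.Prime).ne_zero
      refine ⟨n + m, d, c * d ^ (p ^ m - 1) + c' * d ^ (p ^ n - 1), hd, ?_⟩
      rw [add_mul, mul_assoc, pow_sub_one_mul (hp m), mul_assoc, pow_sub_one_mul (hp n), h1, h2]
    | smul r x _ hx =>
      obtain ⟨n, b, c, hb, rfl⟩ := hx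
      exact ⟨n, b, r * c, hb, by rw [smul_eq_mul, mul_assoc]⟩
  · rintro ⟨n, b, c, hb, rfl⟩
    exact Ideal.mul_mem_left _ _ (Ideal.subset_span ⟨n, hb⟩)

omit [Fact p.Prime] in
theorem mk_S₂_eq_zero_iff {x : S} : algebraMap S (S₂ p a) x = 0 ↔ x ∈ rootIdeal p a :=
  Ideal.Quotient.eq_zero_iff_mem

omit [Fact p.Prime] in
theorem mk_S₂_self : algebraMap S (S₂ p a) a = 0 :=
  mk_S₂_eq_zero_iff.mpr (Ideal.subset_span ⟨0, by simp⟩)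

/-- The `p`-th root of `c a^{1/p^n}` is `c^{1/p} a^{1/p^{n+1}}`, again in the root ideal. -/
theorem isPerfect_S₂ (hS : IsPerfect p S) : IsPerfect p (S₂ p a) := by
  refine hS.of_surjective (algebraMap S _) S₂_surjective fun x hx => ?_
  rw [mk_S₂_eq_zero_iff, mem_rootIdeal_iff hS] at hx ⊢
  obtain ⟨n, b, c, hb, hx⟩ := hx
  obtain ⟨b, rfl⟩ := hS.bijective_frobenius.2 b
  obtain ⟨c, rfl⟩ := hS.bijective_frobenius.2 c
  refine ⟨n + 1, b, c, ?_, hS.bijective_frobenius.1 ?_⟩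
  · rw [← hb, pow_succ', pow_mul]
  · change x ^ p = (c * b) ^ p
    rw [hx, mul_pow]

/-- If `x = c b` with `b ^ p ^ n = a`, then `x b ^ p ^ n = 0`. Root closure gives `x b = 0`, whence
`x² = c x b = 0`. -/
theorem eq_zero_of_mem_rootIdeal (hS : IsPerfect p S) {x : S} (hx : x ∈ rootIdeal p a)
    (h : a * x = 0) : x = 0 := by
  obtain ⟨n, b, c, rfl, rfl⟩ := (mem_rootIdeal_iff hS).mp hx
  have h1 := hS.mul_eq_zero_of_mul_pow (a := c * b) (x := b)
    (pow_ne_zero n (Fact.out : p.Prime).ne_zero) (by rw [mul_comm]; exact h)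
  refine hS.eq_zero_of_pow_eq_zero (n := 2) ?_
  linear_combination c * h1

omit [Fact p.Prime] in
theorem includeRight_S₁₂_surjective : Function.Surjective
    (Algebra.TensorProduct.includeRight : S₂ p a →ₐ[S] S₁₂ p a) := by
  intro z
  induction z with
  | zero => exact ⟨0, map_zero _⟩
  | add x y hx hy =>
    obtain ⟨x, rfl⟩ := hx
    obtain ⟨y, rfl⟩ := hy
    exact ⟨x + y, map_add _ _ _⟩
  | tmul x y =>
    obtain ⟨s, rfl⟩ := S₁_surjective x
    refine ⟨s • y, ?_⟩
    rw [Algebra.TensorProduct.includeRight_apply, TensorProduct.tmul_smul,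
      TensorProduct.smul_tmul', Algebra.algebraMap_eq_smul_one]

-- Mapping `S₁₂` to `S/(Ann(a) + (a^{p^{-∞}}))` shows that a representative of `y` lies in this sum;
-- its `Ann(a)` part is the required `s`.
omit [Fact p.Prime] in
theorem exists_of_includeRight_S₁₂_eq_zero {y : S₂ p a}
    (hy : (Algebra.TensorProduct.includeRight : S₂ p a →ₐ[S] S₁₂ p a) y = 0) :
    ∃ s, a * s = 0 ∧ algebraMap S (S₂ p a) s = y := by
  obtain ⟨s, rfl⟩ := S₂_surjective y
  have h := congrArg (Algebra.TensorProduct.productMap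
    (Ideal.Quotient.factorₐ S (le_sup_left : (Ideal.span {a}).annihilator ≤
      (Ideal.span {a}).annihilator ⊔ rootIdeal p a))
    (Ideal.Quotient.factorₐ S (le_sup_right : rootIdeal p a ≤
      (Ideal.span {a}).annihilator ⊔ rootIdeal p a))) hy
  rw [Algebra.TensorProduct.includeRight_apply, Algebra.TensorProduct.productMap_right_apply,
    map_zero] at h
  obtain ⟨i, hi, j, hj, rfl⟩ := Submodule.mem_sup.mp (Ideal.Quotient.eq_zero_iff_mem.mp h)
  refine ⟨i, mk_S₁_eq_zero_iff.mp (Ideal.Quotient.eq_zero_iff_mem.mpr hi), ?_⟩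
  rw [map_add, mk_S₂_eq_zero_iff.mpr hj, add_zero]

theorem isPerfect_S₁₂ (hS : IsPerfect p S) : IsPerfect p (S₁₂ p a) := by
  have h₂ := isPerfect_S₂ (a := a) hS
  refine h₂.of_surjective
    (Algebra.TensorProduct.includeRight : S₂ p a →ₐ[S] S₁₂ p a).toRingHom
    includeRight_S₁₂_surjective fun x hx => ?_
  obtain ⟨s, hs, hx⟩ := exists_of_includeRight_S₁₂_eq_zero hx
  obtain ⟨s, rfl⟩ := hS.bijective_frobenius.2 s
  have hx' : x = algebraMap S _ s := h₂.bijective_frobenius.1 (hx.symm.trans (map_pow _ _ _))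
  rw [hx']
  have : algebraMap S (S₁ a) s = 0 := mk_S₁_eq_zero_iff.mpr
    (hS.mul_eq_zero_of_mul_pow (Fact.out : p.Prime).ne_zero hs)
  refine ((Algebra.TensorProduct.includeRight : S₂ p a →ₐ[S] S₁₂ p a).commutes s).trans ?_
  rw [← (Algebra.TensorProduct.includeLeft : S₁ a →ₐ[S] S₁₂ p a).commutes s, this, map_zero]

end Quotients

/-! ### Adic completeness with respect to a principal ideal -/

section Complete

variable {S : Type u} [CommRing S] {a : S}

theorem mem_span_singleton_pow_iff {x : S} {n : ℕ} :
    x ∈ (Ideal.span {a} ^ n • ⊤ : Ideal S) ↔ ∃ c, x = a ^ n * c := by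
  rw [smul_eq_mul, Ideal.mul_top, Ideal.span_singleton_pow, Ideal.mem_span_singleton]
  rfl

theorem eq_zero_of_forall_eq_pow_mul (h : IsAdicComplete (Ideal.span {a}) S) {x : S}
    (hx : ∀ n, ∃ c, x = a ^ n * c) : x = 0 :=
  h.haus' x fun n => SModEq.zero.mpr (mem_span_singleton_pow_iff.mpr (hx n))

theorem exists_limit (h : IsAdicComplete (Ideal.span {a}) S) (s : ℕ → S)
    (hs : ∀ n, ∃ c, s (n + 1) - s n = a ^ n * c) : ∃ l, ∀ n, ∃ c, l - s n = a ^ n * c := by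
  obtain ⟨l, hl⟩ := h.prec' s ((AdicCompletion.isAdicCauchy_iff _ _ s).mpr fun n =>
    (SModEq.sub_mem.mpr (mem_span_singleton_pow_iff.mpr (hs n))).symm)
  exact ⟨l, fun n => mem_span_singleton_pow_iff.mp (SModEq.sub_mem.mp (hl n).symm)⟩

theorem isAdicComplete_of_forall
    (h₁ : ∀ x : S, (∀ n, ∃ c, x = a ^ n * c) → x = 0)
    (h₂ : ∀ s : ℕ → S, (∀ n, ∃ c, s (n + 1) - s n = a ^ n * c) →
      ∃ l, ∀ n, ∃ c, l - s n = a ^ n * c) : IsAdicComplete (Ideal.span {a}) S where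
  haus' x hx := h₁ x fun n => mem_span_singleton_pow_iff.mp (SModEq.zero.mp (hx n))
  prec' s hs := by
    obtain ⟨l, hl⟩ := h₂ s fun n =>
      mem_span_singleton_pow_iff.mp (SModEq.sub_mem.mp (hs n.le_succ).symm)
    exact ⟨l, fun n => (SModEq.sub_mem.mpr (mem_span_singleton_pow_iff.mpr (hl n))).symm⟩

/-- Separatedness: `x ≡ a ^ n c` modulo `Ann(a)` gives `a x = a ^ n (a c)`, so `a x` lies in every
`a ^ n S` and is zero. For limits, the successive differences are lifted to `S` and summed there. -/
theorem isAdicComplete_S₁ (h : IsAdicComplete (Ideal.span {a}) S) :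
    IsAdicComplete (Ideal.span {algebraMap S (S₁ a) a}) (S₁ a) := by
  refine isAdicComplete_of_forall (fun x hx => ?_) fun s hs => ?_
  · obtain ⟨x, rfl⟩ := S₁_surjective x
    refine mk_S₁_eq_zero_iff.mpr (eq_zero_of_forall_eq_pow_mul h fun n => ?_)
    obtain ⟨c, hc⟩ := hx n
    obtain ⟨c, rfl⟩ := S₁_surjective c
    rw [← map_pow, ← map_mul, ← sub_eq_zero, ← map_sub, mk_S₁_eq_zero_iff] at hc
    exact ⟨a * c, by linear_combination hc⟩
  · choose c hc using hs
    choose c' hc' using fun n => S₁_surjective (c n)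
    obtain ⟨s₀, hs₀⟩ := S₁_surjective (s 0)
    let t : ℕ → S := fun n => s₀ + ∑ i ∈ Finset.range n, a ^ i * c' i
    have ht : ∀ n, t (n + 1) - t n = a ^ n * c' n := fun n => by
      simp only [t, Finset.sum_range_succ]
      ring
    have hst : ∀ n, algebraMap S (S₁ a) (t n) = s n := by
      intro n
      induction n with
      | zero => simp only [t, Finset.range_zero, Finset.sum_empty, add_zero, hs₀]
      | succ n ih =>
        rw [eq_add_of_sub_eq (ht n), map_add, map_mul, map_pow, ih, hc']
        linear_combination -hc n
    obtain ⟨l, hl⟩ := exists_limit h t fun n => ⟨_, ht n⟩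
    refine ⟨algebraMap S _ l, fun n => ?_⟩
    obtain ⟨d, hd⟩ := hl n
    exact ⟨algebraMap S _ d, by rw [← hst, ← map_sub, hd, map_mul, map_pow]⟩

end Complete

end PerfdAcris

namespace PerfdAcris

variable (p : ℕ) [Fact p.Prime]

/-! ### Quotients of rings of Witt vectors -/

section WittQuotients

variable {p} {T k : Type u} [CommRing T] [CommRing k]

theorem witt_constantCoeff_surjective :
    Function.Surjective (WittVector.constantCoeff : WittVector p T →+* T) :=
  fun t => ⟨WittVector.teichmuller p t, by simp⟩

/-- The factorization `T → k` of a homomorphism `W(T) → k` over `W(T)/p = T`. -/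
def wittFactor (hT : IsPerfect p T) (F : WittVector p T →+* k) (hF : F p = 0) : T →+* k :=
  WittVector.constantCoeff.liftOfSurjective witt_constantCoeff_surjective ⟨F, fun x hx => by
    obtain ⟨y, rfl⟩ := Ideal.mem_span_singleton'.mp (witt_mem_span_p p hT hx)
    rw [RingHom.mem_ker, map_mul, hF, mul_zero]⟩

theorem wittFactor_coeff_zero (hT : IsPerfect p T) (F : WittVector p T →+* k) (hF : F p = 0)
    (x : WittVector p T) : wittFactor hT F hF (x.coeff 0) = F x :=
  RingHom.liftOfSurjective_comp_apply WittVector.constantCoeff witt_constantCoeff_surjective _ x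

theorem wittFactor_eq (hT : IsPerfect p T) (F : WittVector p T →+* k) (hF : F p = 0) (t : T) :
    wittFactor hT F hF t = F (WittVector.teichmuller p t) := by
  rw [← wittFactor_coeff_zero hT F hF, WittVector.teichmuller_coeff_zero]

theorem wittFactor_surjective (hT : IsPerfect p T) (F : WittVector p T →+* k) (hF : F p = 0)
    (h : Function.Surjective F) : Function.Surjective (wittFactor hT F hF) := by
  intro y
  obtain ⟨x, rfl⟩ := h y
  exact ⟨_, wittFactor_coeff_zero hT F hF x⟩

/-- In `W(T)` with `T` perfect, an element `(0, ξ₁, …)` with `ξ₁` a unit is associated to `p`. -/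
theorem natCast_p_mem_span_of_coeff (hT : IsPerfect p T) {ξ : WittVector p T}
    (h₀ : ξ.coeff 0 = 0) (h₁ : IsUnit (ξ.coeff 1)) : (p : WittVector p T) ∈ Ideal.span {ξ} := by
  rcases subsingleton_or_nontrivial T with h | h
  · have : (p : WittVector p T) = 0 := by
      ext n
      exact Subsingleton.elim _ _
    rw [this]
    exact zero_mem _
  have : CharP T p := (CharP.charP_iff_prime_eq_zero Fact.out).mpr hT.p_eq_zero
  have := witt_isAdicComplete p hT
  obtain ⟨y, rfl⟩ := Ideal.mem_span_singleton'.mp (witt_mem_span_p p hT h₀)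
  -- From `ξ = y p` one gets `ξ₁ = y₀ ^ p`.
  have hy : IsUnit (y.coeff 0) := by
    rw [← isUnit_pow_iff (Fact.out : p.Prime).ne_zero]
    convert h₁ using 1
    rw [WittVector.mul_charP_coeff_succ]
  -- By `p`-adic completeness `p` lies in the Jacobson radical, so a unit modulo `p` is a unit.
  have hy : IsUnit y := by
    obtain ⟨z, hz⟩ := hy.exists_right_inv
    have hm : y * WittVector.teichmuller p z - 1 ∈ Ideal.span {(p : WittVector p T)} := by
      refine witt_mem_span_p p hT ?_
      change WittVector.constantCoeff (y * WittVector.teichmuller p z - 1) = 0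
      rw [map_sub, map_mul, map_one]
      simp [hz]
    have hj := IsAdicComplete.le_jacobson_bot _ hm
    rw [Ideal.mem_jacobson_bot] at hj
    have := hj 1
    rw [mul_one, sub_add_cancel] at this
    exact isUnit_of_mul_isUnit_left this
  obtain ⟨u, rfl⟩ := hy
  rw [Ideal.mem_span_singleton']
  exact ⟨↑u⁻¹, by rw [← mul_assoc, Units.inv_mul, one_mul]⟩

theorem mk_p_eq_zero (hT : IsPerfect p T) {ξ : WittVector p T}
    (h₀ : ξ.coeff 0 = 0) (h₁ : IsUnit (ξ.coeff 1)) :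
    Ideal.Quotient.mk (Ideal.span {ξ}) (p : WittVector p T) = 0 :=
  Ideal.Quotient.eq_zero_iff_mem.mpr (natCast_p_mem_span_of_coeff hT h₀ h₁)

/-- The isomorphism `T ≅ W(T)/ξ` for `ξ` associated to `p`. -/
def wittQuotEquiv (hT : IsPerfect p T) {ξ : WittVector p T}
    (h₀ : ξ.coeff 0 = 0) (h₁ : IsUnit (ξ.coeff 1)) : T ≃+* WittVector p T ⧸ Ideal.span {ξ} :=
  RingEquiv.ofBijective (wittFactor hT (Ideal.Quotient.mk _) (mk_p_eq_zero hT h₀ h₁)) <| by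
    refine ⟨?_, wittFactor_surjective hT _ _ Ideal.Quotient.mk_surjective⟩
    rw [injective_iff_map_eq_zero]
    intro t ht
    rw [wittFactor_eq, Ideal.Quotient.eq_zero_iff_mem, Ideal.mem_span_singleton'] at ht
    obtain ⟨c, hc⟩ := ht
    have := congrArg WittVector.constantCoeff hc
    simp only [map_mul] at this
    simpa [h₀] using this.symm

theorem wittQuotEquiv_coeff_zero (hT : IsPerfect p T) {ξ : WittVector p T}
    (h₀ : ξ.coeff 0 = 0) (h₁ : IsUnit (ξ.coeff 1)) (x : WittVector p T) :
    wittQuotEquiv hT h₀ h₁ (x.coeff 0) = Ideal.Quotient.mk _ x :=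
  wittFactor_coeff_zero hT (Ideal.Quotient.mk _) (mk_p_eq_zero hT h₀ h₁) x

/-- If `p x = y ξ`, reduction modulo `p` gives `ξ₀ y₀ = 0`. Hence `p` divides `y`, and cancelling it
shows that `ξ` divides `x`. -/
theorem wittQuot_isTorsionFree (hT : IsPerfect p T) {ξ : WittVector p T}
    (h : ∀ x, ξ.coeff 0 * x = 0 → x = 0) :
    IsTorsionFree p (WittVector p T ⧸ Ideal.span {ξ}) := by
  intro x hx
  obtain ⟨x, rfl⟩ := Ideal.Quotient.mk_surjective x
  rw [← map_natCast (Ideal.Quotient.mk _), ← map_mul, Ideal.Quotient.eq_zero_iff_mem,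
    Ideal.mem_span_singleton'] at hx
  obtain ⟨y, hy⟩ := hx
  have hy₀ : y.coeff 0 = 0 := by
    refine h _ ?_
    have := congrArg WittVector.constantCoeff hy
    rw [map_mul, map_mul, map_natCast, hT.p_eq_zero, zero_mul, mul_comm] at this
    exact this
  obtain ⟨y, rfl⟩ := Ideal.mem_span_singleton'.mp (witt_mem_span_p p hT hy₀)
  rw [Ideal.Quotient.eq_zero_iff_mem, Ideal.mem_span_singleton']
  exact ⟨y, witt_p_mul_cancel hT (by linear_combination hy)⟩

end WittQuotients

/-! ### The tilt of a perfectoid ring -/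

section Tilt

variable {p} {S R : Type u} [CommRing S] [CommRing R]

theorem IsPerfect.exists_powEquiv (hS : IsPerfect p S) (n : ℕ) :
    ∃ F : S ≃+* S, ∀ s, F s = s ^ p ^ n := by
  let F : S →+* S :=
    { toFun := fun x => x ^ p ^ n
      map_one' := one_pow _
      map_mul' := fun x y => mul_pow _ _ _
      map_zero' := zero_pow (pow_ne_zero _ (Fact.out : p.Prime).ne_zero)
      map_add' := fun x y => by
        obtain ⟨r, hr⟩ := exists_add_pow_prime_pow_eq (Fact.out : p.Prime) x y n
        rw [hr, hS.p_eq_zero]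
        ring }
  exact ⟨RingEquiv.ofBijective F ⟨hS.pow_injective n, hS.pow_surjective n⟩, fun s => rfl⟩

/-- The automorphism `x ↦ x ^ (p ^ n)` of a perfect ring. -/
def powEquiv (hS : IsPerfect p S) (n : ℕ) : S ≃+* S := (hS.exists_powEquiv n).choose

theorem powEquiv_apply (hS : IsPerfect p S) (n : ℕ) (s : S) : powEquiv hS n s = s ^ p ^ n :=
  (hS.exists_powEquiv n).choose_spec s

theorem powEquiv_symm_pow (hS : IsPerfect p S) (n : ℕ) (s : S) :
    (powEquiv hS n).symm s ^ p ^ n = s := by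
  rw [← powEquiv_apply hS, RingEquiv.apply_symm_apply]

theorem powEquiv_symm_pow_eq (hS : IsPerfect p S) (n : ℕ) (s : S) :
    (powEquiv hS n).symm (s ^ p ^ n) = s := by
  rw [← powEquiv_apply hS, RingEquiv.symm_apply_apply]

theorem powEquiv_symm_succ_pow (hS : IsPerfect p S) (n : ℕ) (s : S) :
    (powEquiv hS (n + 1)).symm s ^ p = (powEquiv hS n).symm s := by
  refine hS.pow_injective n ?_
  change ((powEquiv hS (n + 1)).symm s ^ p) ^ p ^ n = (powEquiv hS n).symm s ^ p ^ n
  rw [powEquiv_symm_pow, ← pow_mul, ← pow_succ', powEquiv_symm_pow]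

/-- The homomorphism `S → R^♭` given by `σ : S → R/p` for a perfect ring `S`. -/
def toTilt (hS : IsPerfect p S) (σ : S →+* ModP p R) : S →+* Tilt p R :=
  (RingHom.pi fun n => σ.comp (powEquiv hS n).symm.toRingHom).codRestrict (Tilt p R) fun s n => by
    change σ ((powEquiv hS (n + 1)).symm s) ^ p = σ ((powEquiv hS n).symm s)
    rw [← map_pow, powEquiv_symm_succ_pow]

theorem toTilt_apply (hS : IsPerfect p S) (σ : S →+* ModP p R) (s : S) (n : ℕ) :
    (toTilt hS σ s).1 n = σ ((powEquiv hS n).symm s) := rfl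

theorem toModP_toTilt (hS : IsPerfect p S) (σ : S →+* ModP p R) (s : S) :
    Tilt.toModP p (toTilt hS σ s) = σ s := by
  have h := powEquiv_symm_pow hS 0 s
  rw [pow_zero, pow_one] at h
  change σ ((powEquiv hS 0).symm s) = σ s
  rw [h]

variable {a : S} {σ : S →+* ModP p R}

/-- If all the roots `s^{1/p^n}` lie in `(a)`, then `s` lies in every `(a^{p^n})`, and `S` is
`a`-adically separated. -/
theorem toTilt_injective (hS : IsPerfect p S) (ha : IsAdicComplete (Ideal.span {a}) S)
    (hker : ∀ s, σ s = 0 → ∃ c, s = a * c) : Function.Injective (toTilt hS σ) := by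
  rw [injective_iff_map_eq_zero]
  intro s hs
  refine eq_zero_of_forall_eq_pow_mul ha fun n => ?_
  obtain ⟨c, hc⟩ := hker ((powEquiv hS n).symm s) (congrFun (congrArg Subtype.val hs) n)
  have h := powEquiv_symm_pow hS n s
  obtain ⟨m, hm⟩ := Nat.exists_eq_add_of_le (Nat.lt_pow_self (n := n) (Fact.out : p.Prime).one_lt).le
  rw [hc, mul_pow] at h
  nth_rewrite 1 [hm] at h
  exact ⟨a ^ m * c ^ p ^ n, by rw [← h, pow_add, mul_assoc]⟩

/-- Lift the components of `t` to `s_n ∈ S`. As `s_{n+1}^p ≡ s_n` modulo `a`, the sequence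
`s_n^{p^n}` is `a`-adically Cauchy, and its limit maps to `t`. -/
theorem toTilt_surjective (hS : IsPerfect p S) (ha : IsAdicComplete (Ideal.span {a}) S)
    (hker : ∀ s, σ s = 0 → ∃ c, s = a * c) (hσa : σ a = 0) (hσ : Function.Surjective σ) :
    Function.Surjective (toTilt hS σ) := by
  intro t
  choose s hs using fun n => hσ (t.1 n)
  have hstep : ∀ n, ∃ c, s (n + 1) ^ p ^ (n + 1) - s n ^ p ^ n = a ^ p ^ n * c := by
    intro n
    obtain ⟨c, hc⟩ := hker (s (n + 1) ^ p - s n) (by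
      rw [map_sub, map_pow, hs, hs, t.2 n, sub_self])
    have := congrArg (powEquiv hS n) hc
    rw [map_sub, map_mul, powEquiv_apply, powEquiv_apply, powEquiv_apply, powEquiv_apply,
      ← pow_mul, ← pow_succ'] at this
    exact ⟨_, this⟩
  have hle : ∀ n, n ≤ p ^ n := fun n => (Nat.lt_pow_self (Fact.out : p.Prime).one_lt).le
  obtain ⟨l, hl⟩ := exists_limit ha (fun n => s n ^ p ^ n) fun n => by
    obtain ⟨c, hc⟩ := hstep n
    obtain ⟨m, hm⟩ := Nat.exists_eq_add_of_le (hle n)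
    exact ⟨a ^ m * c, by rw [hc, hm, pow_add, mul_assoc]⟩
  have hdist : ∀ n k, ∃ c, s (n + k) ^ p ^ (n + k) - s n ^ p ^ n = a ^ p ^ n * c := by
    intro n k
    induction k with
    | zero => exact ⟨0, by simp⟩
    | succ k ih =>
      obtain ⟨c, hc⟩ := ih
      obtain ⟨c', hc'⟩ := hstep (n + k)
      obtain ⟨m, hm⟩ := Nat.exists_eq_add_of_le
        (Nat.pow_le_pow_right (Fact.out : p.Prime).pos (Nat.le_add_right n k))
      have ham : a ^ p ^ (n + k) = a ^ p ^ n * a ^ m := by rw [hm, pow_add]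
      rw [ham] at hc'
      exact ⟨c + a ^ m * c', by rw [← add_assoc]; linear_combination hc + hc'⟩
  refine ⟨l, Subtype.ext (funext fun n => ?_)⟩
  obtain ⟨k, hk⟩ := Nat.exists_eq_add_of_le (hle n)
  -- Index `p ^ n` makes the error divisible by `a ^ p ^ n`; after extracting `p ^ n`-th roots it is
  -- divisible by `a`, so `σ` kills it.
  obtain ⟨c, hc⟩ := hl (p ^ n)
  obtain ⟨c', hc'⟩ := hdist n k
  rw [← hk] at hc'
  have h : l = s n ^ p ^ n + a ^ p ^ n * (c + c') := by linear_combination hc + hc'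
  rw [toTilt_apply, h, map_add, map_mul, powEquiv_symm_pow_eq, powEquiv_symm_pow_eq, map_add,
    map_mul, hσa, zero_mul, add_zero, hs]

theorem tilt_isPerfect : IsPerfect p (Tilt p R) := by
  refine ⟨Tilt.p_eq_zero p, ?_, ?_⟩
  · intro x y hxy
    refine Subtype.ext (funext fun n => ?_)
    rw [← x.2 n, ← y.2 n]
    exact congrFun (congrArg Subtype.val hxy) (n + 1)
  · intro x
    exact ⟨⟨fun n => x.1 (n + 1), fun n => x.2 (n + 1)⟩, Subtype.ext (funext fun n => x.2 n)⟩

theorem map_toTilt {S' R' : Type u} [CommRing S'] [CommRing R'] (hS : IsPerfect p S)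
    (hS' : IsPerfect p S') {σ' : S' →+* ModP p R'} (f : S →+* S') (r : R →+* R')
    (h : ∀ s, ModP.map p r (σ s) = σ' (f s)) (s : S) :
    Tilt.map p r (toTilt hS σ s) = toTilt hS' σ' (f s) := by
  refine Subtype.ext (funext fun n => ?_)
  change ModP.map p r (σ ((powEquiv hS n).symm s)) = σ' ((powEquiv hS' n).symm (f s))
  rw [h]
  congr 1
  refine hS'.pow_injective n ?_
  change f ((powEquiv hS n).symm s) ^ p ^ n = (powEquiv hS' n).symm (f s) ^ p ^ n
  rw [powEquiv_symm_pow, ← map_pow, powEquiv_symm_pow]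

end Tilt

/-! ### The map `S → R/p` for a perfectoid ring `R = W(S)/ξ` -/

section Reduction

variable {p} {S R : Type u} [CommRing S] [CommRing R] (hS : IsPerfect p S) {ξ : WittVector p S}
  (e : R ≃+* WittVector p S ⧸ Ideal.span {ξ})

/-- The homomorphism `S = W(S)/p → R/p` for `R = W(S)/ξ`. -/
def perfdToModP : S →+* ModP p R :=
  wittFactor hS ((Ideal.Quotient.mk _).comp (e.symm.toRingHom.comp (Ideal.Quotient.mk _)))
    (by rw [map_natCast, ModP.p_eq_zero])

theorem perfdToModP_coeff_zero (x : WittVector p S) : perfdToModP hS e (x.coeff 0) =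
    Ideal.Quotient.mk _ (e.symm (Ideal.Quotient.mk _ x)) :=
  wittFactor_coeff_zero hS _ _ x

theorem perfdToModP_surjective : Function.Surjective (perfdToModP hS e) :=
  wittFactor_surjective hS _ _
    (Ideal.Quotient.mk_surjective.comp (e.symm.surjective.comp Ideal.Quotient.mk_surjective))

/-- Both `R/p` and `S/ξ₀` are the quotient `W(S)/(p, ξ)`. -/
theorem perfdToModP_eq_zero_iff (s : S) :
    perfdToModP hS e s = 0 ↔ ∃ c, s = ξ.coeff 0 * c := by
  constructor
  · intro h
    rw [← WittVector.teichmuller_coeff_zero (p := p) s, perfdToModP_coeff_zero,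
      Ideal.Quotient.eq_zero_iff_mem, Ideal.mem_span_singleton'] at h
    obtain ⟨r, hr⟩ := h
    obtain ⟨y, hy⟩ := Ideal.Quotient.mk_surjective (e r)
    have h := congrArg e hr
    rw [RingEquiv.apply_symm_apply, map_mul, map_natCast, ← hy,
      ← map_natCast (Ideal.Quotient.mk _), ← map_mul, eq_comm, Ideal.Quotient.eq,
      Ideal.mem_span_singleton'] at h
    obtain ⟨c, hc⟩ := h
    have := congrArg WittVector.constantCoeff hc
    rw [map_mul, map_sub, map_mul, map_natCast, hS.p_eq_zero, mul_zero, sub_zero] at this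
    exact ⟨c.coeff 0, by simpa [mul_comm] using this.symm⟩
  · rintro ⟨c, rfl⟩
    have h := perfdToModP_coeff_zero hS e ξ
    rw [Ideal.Quotient.eq_zero_iff_mem.mpr (Ideal.mem_span_singleton_self ξ), map_zero,
      map_zero] at h
    rw [map_mul, h, zero_mul]

/-- If two homomorphisms agree on Witt vectors, then `S → R/p` is compatible with them. -/
theorem modP_map_perfdToModP {S' R' : Type u} [CommRing S'] [CommRing R'] (hS' : IsPerfect p S')
    {ξ' : WittVector p S'} (e' : R' ≃+* WittVector p S' ⧸ Ideal.span {ξ'}) (f : S →+* S')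
    (r : R →+* R')
    (h : ∀ x, e' (r (e.symm (Ideal.Quotient.mk _ x))) = Ideal.Quotient.mk _ (WittVector.map f x))
    (s : S) : ModP.map p r (perfdToModP hS e s) = perfdToModP hS' e' (f s) := by
  rw [← WittVector.teichmuller_coeff_zero (p := p) s, perfdToModP_coeff_zero,
    ← WittVector.map_coeff, perfdToModP_coeff_zero, ← h, RingEquiv.symm_apply_apply]
  rfl

theorem modP_lift_perfdToModP {T k : Type u} [CommRing T] [CommRing k] (hk : (p : k) = 0)
    (r : R →+* k) (f : S →+* T) (ρ : T →+* k)
    (h : ∀ x, r (e.symm (Ideal.Quotient.mk _ x)) = ρ ((WittVector.map f x).coeff 0))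
    (s : S) : ModP.lift p r hk (perfdToModP hS e s) = ρ (f s) := by
  rw [← WittVector.teichmuller_coeff_zero (p := p) s, perfdToModP_coeff_zero,
    ← WittVector.map_coeff, ← h]
  rfl

end Reduction

end PerfdAcris

namespace PerfdAcris

variable (p : ℕ) [Fact p.Prime]

/-! ### The decomposition of a perfectoid ring -/

section Main

variable {p} {S R : Type u} [CommRing S] [CommRing R] (hS : IsPerfect p S) {ξ : WittVector p S}
  (hξ : IsDistinguished p ξ) (e : R ≃+* WittVector p S ⧸ Ideal.span {ξ})

theorem IsDistinguished.map_S₁ (hξ : IsDistinguished p ξ) :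
    IsDistinguished p (WittVector.map (algebraMap S (S₁ (ξ.coeff 0))) ξ) := by
  refine ⟨?_, ?_⟩
  · rw [WittVector.map_coeff]
    exact hξ.isUnit.map _
  · rw [WittVector.map_coeff]
    exact isAdicComplete_S₁ hξ.complete

include hS hξ in
theorem isPerfectoid_wittQuot_S₁ : IsPerfectoid p (WittQuot p ξ (S₁ (ξ.coeff 0))) :=
  ⟨_, _, _, isPerfect_S₁ hS, hξ.map_S₁, ⟨RingEquiv.refl _⟩⟩

include hS in
theorem isTorsionFree_wittQuot_S₁ : IsTorsionFree p (WittQuot p ξ (S₁ (ξ.coeff 0))) := by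
  refine wittQuot_isTorsionFree (isPerfect_S₁ hS) ?_
  rw [WittVector.map_coeff]
  exact regular_of_ker_eq_annihilator hS S₁_surjective fun _ => mk_S₁_eq_zero_iff

/-- The isomorphism `T ≅ W(T)/ξ` for a perfect `S`-algebra `T` annihilated by `ξ₀`. -/
def wittQuotEquivOfAlgebra (hξ : IsDistinguished p ξ) {T : Type u} [CommRing T] [Algebra S T]
    (hT : IsPerfect p T) (h₀ : algebraMap S T (ξ.coeff 0) = 0) : T ≃+* WittQuot p ξ T :=
  wittQuotEquiv hT ((WittVector.map_coeff _ _ _).trans h₀)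
    (by rw [WittVector.map_coeff]; exact hξ.isUnit.map _)

theorem wittQuotEquivOfAlgebra_coeff_zero {T : Type u} [CommRing T] [Algebra S T]
    (hT : IsPerfect p T) (h₀ : algebraMap S T (ξ.coeff 0) = 0) (x : WittVector p T) :
    wittQuotEquivOfAlgebra hξ hT h₀ (x.coeff 0) = Ideal.Quotient.mk _ x :=
  wittQuotEquiv_coeff_zero hT _ _ x

theorem wittQuot_map_equiv {T T' : Type u} [CommRing T] [Algebra S T] [CommRing T'] [Algebra S T']
    (hT : IsPerfect p T) (h₀ : algebraMap S T (ξ.coeff 0) = 0)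
    (hT' : IsPerfect p T') (h₀' : algebraMap S T' (ξ.coeff 0) = 0) (f : T →ₐ[S] T') (t : T) :
    WittQuot.map p ξ f (wittQuotEquivOfAlgebra hξ hT h₀ t) =
      wittQuotEquivOfAlgebra hξ hT' h₀' (f t) := by
  obtain ⟨x, rfl⟩ := witt_constantCoeff_surjective (p := p) t
  refine (congrArg _ (wittQuotEquivOfAlgebra_coeff_zero hξ hT h₀ x)).trans ?_
  exact (wittQuotEquivOfAlgebra_coeff_zero hξ hT' h₀' (WittVector.map f.toRingHom x)).symm

omit [Fact p.Prime] in
theorem algebraMap_S₁₂_self (a : S) : algebraMap S (S₁₂ p a) a = 0 := by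
  rw [← (Algebra.TensorProduct.includeRight : S₂ p a →ₐ[S] S₁₂ p a).commutes, mk_S₂_self,
    map_zero]

/-- The isomorphism `S ≅ R^♭` for `R = W(S)/ξ`. -/
def tiltEquiv (hξ : IsDistinguished p ξ) : S ≃+* Tilt p R :=
  RingEquiv.ofBijective (toTilt hS (perfdToModP hS e))
    ⟨toTilt_injective hS hξ.complete fun s => (perfdToModP_eq_zero_iff hS e s).mp,
      toTilt_surjective hS hξ.complete (fun s => (perfdToModP_eq_zero_iff hS e s).mp)
        ((perfdToModP_eq_zero_iff hS e _).mpr ⟨1, (mul_one _).symm⟩)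
        (perfdToModP_surjective hS e)⟩

theorem toModP_tiltEquiv (s : S) :
    Tilt.toModP p (tiltEquiv hS e hξ s) = perfdToModP hS e s :=
  toModP_toTilt hS _ s

/-- This is the form of the kernel, `(p, [a])` with `a` the image of `ξ₀`, in which the results on
envelopes over `W(T)` are applied. -/
theorem mem_ker_wittToModP_iff (x : WittVector p (Tilt p R)) :
    x ∈ RingHom.ker (wittToModP p R) ↔ ∃ t, x.coeff 0 = tiltEquiv hS e hξ (ξ.coeff 0) * t := by
  rw [RingHom.mem_ker, wittToModP_apply]
  obtain ⟨s, hs⟩ := (tiltEquiv hS e hξ).surjective (x.coeff 0)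
  rw [← hs, toModP_tiltEquiv, perfdToModP_eq_zero_iff]
  constructor
  · rintro ⟨c, rfl⟩
    exact ⟨_, map_mul _ _ _⟩
  · rintro ⟨t, ht⟩
    obtain ⟨c, rfl⟩ := (tiltEquiv hS e hξ).surjective t
    exact ⟨c, (tiltEquiv hS e hξ).injective (by rw [ht, map_mul])⟩

/-- The map `R → W(T)/ξ` for `R = W(S)/ξ` and an `S`-algebra `T`. -/
abbrev toWittQuot (T : Type u) [CommRing T] [Algebra S T] : R →+* WittQuot p ξ T :=
  (WittQuot.ofBase p ξ T).comp e.toRingHom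

theorem toWittQuot_symm_mk (T : Type u) [CommRing T] [Algebra S T] (x : WittVector p S) :
    toWittQuot e T (e.symm (Ideal.Quotient.mk _ x)) =
      Ideal.Quotient.mk _ (WittVector.map (algebraMap S T) x) := by
  refine (congrArg (WittQuot.ofBase p ξ T) (e.apply_symm_apply _)).trans ?_
  exact Ideal.quotientMap_mk

/-- The isomorphism `S₁ ≅ R₁^♭`. -/
abbrev tiltEquiv₁ : S₁ (ξ.coeff 0) ≃+* Tilt p (WittQuot p ξ (S₁ (ξ.coeff 0))) :=
  tiltEquiv (isPerfect_S₁ hS) (RingEquiv.refl (WittQuot p ξ (S₁ (ξ.coeff 0)))) hξ.map_S₁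

theorem tilt_map_tiltEquiv (s : S) :
    Tilt.map p (toWittQuot e (S₁ (ξ.coeff 0))) (tiltEquiv hS e hξ s) =
      tiltEquiv₁ hS hξ (algebraMap S _ s) :=
  map_toTilt hS (isPerfect_S₁ hS) (algebraMap S _) _
    (modP_map_perfdToModP hS e (isPerfect_S₁ hS) _ (algebraMap S _) _
      (toWittQuot_symm_mk e (S₁ (ξ.coeff 0)))) s

include hS hξ in
theorem tilt_map_surjective :
    Function.Surjective (Tilt.map p (toWittQuot e (S₁ (ξ.coeff 0)))) := by
  intro t
  obtain ⟨s, rfl⟩ := (tiltEquiv₁ hS hξ).surjective t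
  obtain ⟨s, rfl⟩ := S₁_surjective s
  exact ⟨_, tilt_map_tiltEquiv hS hξ e s⟩

theorem tilt_map_eq_zero_iff (t : Tilt p R) :
    Tilt.map p (toWittQuot e (S₁ (ξ.coeff 0))) t = 0 ↔
      tiltEquiv hS e hξ (ξ.coeff 0) * t = 0 := by
  obtain ⟨s, rfl⟩ := (tiltEquiv hS e hξ).surjective t
  rw [tilt_map_tiltEquiv, ← map_mul, map_eq_zero_iff (tiltEquiv₁ hS hξ) (RingEquiv.injective _),
    map_eq_zero_iff (tiltEquiv hS e hξ) (RingEquiv.injective _), mk_S₁_eq_zero_iff]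

theorem mem_ker_wittToModP_S₁_iff
    (x : WittVector p (Tilt p (WittQuot p ξ (S₁ (ξ.coeff 0))))) :
    x ∈ RingHom.ker (wittToModP p (WittQuot p ξ (S₁ (ξ.coeff 0)))) ↔
      ∃ t, x.coeff 0 = Tilt.map p (toWittQuot e (S₁ (ξ.coeff 0)))
        (tiltEquiv hS e hξ (ξ.coeff 0)) * t := by
  have h : tiltEquiv₁ hS hξ ((WittVector.map (algebraMap S (S₁ (ξ.coeff 0))) ξ).coeff 0) =
      Tilt.map p (toWittQuot e (S₁ (ξ.coeff 0))) (tiltEquiv hS e hξ (ξ.coeff 0)) := by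
    rw [tilt_map_tiltEquiv, WittVector.map_coeff]
  rw [← h]
  exact mem_ker_wittToModP_iff (isPerfect_S₁ hS) hξ.map_S₁
    (RingEquiv.refl (WittQuot p ξ (S₁ (ξ.coeff 0)))) x

/-- The isomorphism `S₂ ≅ R₂`. -/
abbrev equiv₂ : S₂ p (ξ.coeff 0) ≃+* WittQuot p ξ (S₂ p (ξ.coeff 0)) :=
  wittQuotEquivOfAlgebra hξ (isPerfect_S₂ hS) mk_S₂_self

/-- The isomorphism `S₁₂ ≅ R₁₂`. -/
abbrev equiv₁₂ : S₁₂ p (ξ.coeff 0) ≃+* WittQuot p ξ (S₁₂ p (ξ.coeff 0)) :=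
  wittQuotEquivOfAlgebra hξ (isPerfect_S₁₂ hS) (algebraMap_S₁₂_self _)

theorem modP_lift_tiltEquiv (hk : (p : WittQuot p ξ (S₂ p (ξ.coeff 0))) = 0) (s : S) :
    ModP.lift p (toWittQuot e (S₂ p (ξ.coeff 0))) hk (Tilt.toModP p (tiltEquiv hS e hξ s)) =
      equiv₂ hS hξ (algebraMap S _ s) := by
  rw [toModP_tiltEquiv]
  refine modP_lift_perfdToModP hS e hk _ (algebraMap S _) (equiv₂ hS hξ).toRingHom (fun x => ?_) s
  rw [toWittQuot_symm_mk]
  exact (wittQuotEquivOfAlgebra_coeff_zero hξ (isPerfect_S₂ hS) mk_S₂_self _).symm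

theorem modP_lift_tiltEquiv₁ (hk : (p : WittQuot p ξ (S₁₂ p (ξ.coeff 0))) = 0)
    (s : S₁ (ξ.coeff 0)) :
    ModP.lift p (WittQuot.map p ξ
      (Algebra.TensorProduct.includeLeft : S₁ (ξ.coeff 0) →ₐ[S] S₁₂ p (ξ.coeff 0))) hk
      (Tilt.toModP p (tiltEquiv₁ hS hξ s)) =
      equiv₁₂ hS hξ (Algebra.TensorProduct.includeLeft (S := S) s) := by
  rw [toModP_tiltEquiv]
  refine modP_lift_perfdToModP (isPerfect_S₁ hS) (RingEquiv.refl _) hk _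
    (Algebra.TensorProduct.includeLeft : S₁ (ξ.coeff 0) →ₐ[S] S₁₂ p (ξ.coeff 0)).toRingHom
    (equiv₁₂ hS hξ).toRingHom (fun x => ?_) s
  exact (wittQuotEquivOfAlgebra_coeff_zero hξ (isPerfect_S₁₂ hS) (algebraMap_S₁₂_self _) _).symm

theorem wittQuot_map_equiv₂ (y : S₂ p (ξ.coeff 0)) :
    WittQuot.map p ξ Algebra.TensorProduct.includeRight (equiv₂ hS hξ y) =
      equiv₁₂ hS hξ (Algebra.TensorProduct.includeRight y) :=
  wittQuot_map_equiv hξ _ _ _ _ _ y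

end Main

end PerfdAcris

end

open PerfdAcris in
theorem mainTheorem12 (p : ℕ) [Fact p.Prime] {S R : Type u} [CommRing S] [CommRing R]
    (hS : IsPerfect p S) (ξ : WittVector p S) (hξ : IsDistinguished p ξ)
    (e : R ≃+* WittVector p S ⧸ Ideal.span {ξ}) :
    let R₁ := WittQuot p ξ (S₁ (ξ.coeff 0))
    let R₂ := WittQuot p ξ (S₂ p (ξ.coeff 0))
    let R₁₂ := WittQuot p ξ (S₁₂ p (ξ.coeff 0))
    let r₁ : R →+* R₁ := (WittQuot.ofBase p ξ (S₁ (ξ.coeff 0))).comp e.toRingHom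
    let r₂ : R →+* R₂ := (WittQuot.ofBase p ξ (S₂ p (ξ.coeff 0))).comp e.toRingHom
    let q₁ : R₁ →+* R₁₂ := WittQuot.map p ξ Algebra.TensorProduct.includeLeft
    let q₂ : R₂ →+* R₁₂ := WittQuot.map p ξ Algebra.TensorProduct.includeRight
    (IsPerfectoid p R₁ ∧ IsTorsionFree p R₁) ∧
    (∃ (h₂ : IsPerfect p R₂) (h₁₂ : IsPerfect p R₁₂),
      let α : Acris p R → Acris p R₁ × WittVector p R₂ :=
        fun x => (Acris.map p r₁ x, Acris.toWitt p r₂ h₂ x)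
      let β : Acris p R₁ × WittVector p R₂ → WittVector p R₁₂ :=
        fun y => Acris.toWitt p q₁ h₁₂ y.1 - WittVector.map q₂ y.2
      Function.Injective α ∧ Function.Exact α β ∧ Function.Surjective β) ∧
    IsTorsionFree p (Acris p R) := by
  intro R₁ R₂ R₁₂ r₁ r₂ q₁ q₂
  have h₂ : IsPerfect p R₂ := (isPerfect_S₂ hS).of_equiv (equiv₂ hS hξ)
  have h₁₂ : IsPerfect p R₁₂ := (isPerfect_S₁₂ hS).of_equiv (equiv₁₂ hS hξ)
  have hq₂ : ∀ y, q₂ (equiv₂ hS hξ y) =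
      equiv₁₂ hS hξ (Algebra.TensorProduct.includeRight y) := wittQuot_map_equiv₂ hS hξ
  -- Transported to `S`, this is `Ann(ξ₀) ∩ (ξ₀^{p^{-∞}}) = 0`.
  have hcap : ∀ t : Tilt p R, tiltEquiv hS e hξ (ξ.coeff 0) * t = 0 →
      ((ModP.lift p r₂ h₂.p_eq_zero).comp (Tilt.toModP p)) t = 0 → t = 0 := by
    intro t ht₁ ht₂
    obtain ⟨s, rfl⟩ := (tiltEquiv hS e hξ).surjective t
    rw [← map_mul, EmbeddingLike.map_eq_zero_iff] at ht₁
    have ht₂ := (modP_lift_tiltEquiv hS hξ e h₂.p_eq_zero s).symm.trans ht₂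
    rw [EmbeddingLike.map_eq_zero_iff, mk_S₂_eq_zero_iff] at ht₂
    rw [eq_zero_of_mem_rootIdeal hS ht₂ ht₁, map_zero]
  have hg : ∀ t : Tilt p R,
      ((ModP.lift p q₁ h₁₂.p_eq_zero).comp (Tilt.toModP p)) (Tilt.map p r₁ t) =
        q₂ (((ModP.lift p r₂ h₂.p_eq_zero).comp (Tilt.toModP p)) t) := by
    intro t
    obtain ⟨s, rfl⟩ := (tiltEquiv hS e hξ).surjective t
    refine (congrArg _ (tilt_map_tiltEquiv hS hξ e s)).trans ?_
    refine (modP_lift_tiltEquiv₁ hS hξ h₁₂.p_eq_zero _).trans ?_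
    refine Eq.trans ?_ (congrArg q₂ (modP_lift_tiltEquiv hS hξ e h₂.p_eq_zero s).symm)
    rw [hq₂, AlgHom.commutes, AlgHom.commutes]
  have hqs : Function.Surjective q₂ := by
    intro z
    obtain ⟨z, rfl⟩ := (equiv₁₂ hS hξ).surjective z
    obtain ⟨y, rfl⟩ := includeRight_S₁₂_surjective z
    exact ⟨_, hq₂ y⟩
  -- Transported to `S`, this says that `Ann(ξ₀)` maps onto the kernel of `S₂ → S₁₂`.
  have hq : ∀ y, q₂ y = 0 → ∃ t : Tilt p R, tiltEquiv hS e hξ (ξ.coeff 0) * t = 0 ∧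
      ((ModP.lift p r₂ h₂.p_eq_zero).comp (Tilt.toModP p)) t = y := by
    intro y hy
    obtain ⟨y, rfl⟩ := (equiv₂ hS hξ).surjective y
    rw [hq₂, EmbeddingLike.map_eq_zero_iff] at hy
    obtain ⟨s, hs, rfl⟩ := exists_of_includeRight_S₁₂_eq_zero hy
    refine ⟨tiltEquiv hS e hξ s, ?_, modP_lift_tiltEquiv hS hξ e h₂.p_eq_zero s⟩
    rw [← map_mul, hs, map_zero]
  have := witt_isAdicComplete p h₂
  have := witt_isAdicComplete p h₁₂
  refine ⟨⟨isPerfectoid_wittQuot_S₁ hS hξ, isTorsionFree_wittQuot_S₁ hS⟩, ⟨h₂, h₁₂, ?_⟩, ?_⟩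
  -- By definition `Acris`, `Acris.map` and `Acris.toWitt` are `PCompletion`, `completionMap` and
  -- `toComplete` for the envelopes over the Witt vectors of the tilts.
  · exact wittEnvelope_completion_exact tilt_isPerfect h₂ h₁₂ (mem_ker_wittToModP_iff hS hξ e)
      (mem_ker_wittToModP_S₁_iff hS hξ e) (isPDTarget_map p r₁) (isPDTarget_ainfToWitt p r₂ h₂)
      (isPDTarget_ainfToWitt p q₁ h₁₂) (tilt_map_surjective hS hξ e)
      (tilt_map_eq_zero_iff hS hξ e) hg hcap hqs hq
  · exact pCompletion_isTorsionFree (wittEnvelope_isTorsionFree_of_sequence tilt_isPerfect h₂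
      (mem_ker_wittToModP_iff hS hξ e) (mem_ker_wittToModP_S₁_iff hS hξ e) (isPDTarget_map p r₁)
      (isPDTarget_ainfToWitt p r₂ h₂) (tilt_map_surjective hS hξ e)
      (tilt_map_eq_zero_iff hS hξ e) hcap)
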